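/- Let $\mathbb F\in\{\mathbb R,\mathbb C\}$, let $d,g\ge 1$ be integers and $\mathbf k=(k_1,\dots,k_g)$ a tuple of positive integers, at least one of which is $\ge 2$. Write $[n]=\{1,\dots,n\}$, let $SM_n(\mathbb F)$ be the self-adjoint $n\times n$ matrices over $\mathbb F$, and let $\preceq$ be the positive semidefinite order. All tuples below are indexed by the pairs $(i,x)$ with $x\in[g]$, $i\in[k_x-1]$; their number is $N=\sum_x (k_x-1)$. *Compatibility.* A POVM on $\mathbb F^d$ with $k$ outcomes is a tuple $(E_i)_{i\in[k]}$ of positive semidefinite $d\times d$ matrices over $\mathbb F$ with $\sum_i E_i=I_d$. A $g$-tuple of POVMs $E=((E_{i|x})_{i\in[k_x]})_{x\in[g]}$ is compatible if there is a POVM $(J_j)_{j\in[k_1]\times\cdots\times[k_g]}$ over $\mathbb F$ with $E_{i|x}=\sum_{j:\,j_x=i}J_j$ for all $i,x$. For $s\in[0,1]$ put $E_{i|x}(s)=sE_{i|x}+(1-s)I_d/k_x$. Let $$s_{\mathbb F}(E)=\max\{s\in[0,1]: (E_{i|x}(s))_{i,x}\text{ is compatible}\},\qquad s_{\mathbb F}(d,g,\mathbf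 k)=\min_E s_{\mathbb F}(E),$$ where $E$ runs over all $g$-tuples of POVMs on $\mathbb F^d$ with $k_1,\dots,k_g$ outcomes. *Matrix jewel and its dual free polytope.* For $i\in[k-1]$ let $v_i^{(k)}\in\mathbb R^k$ be the vector with entries $v_i^{(k)}(\ell)=-\tfrac2k+2\delta_{\ell,i}$. Level $n$ of the matrix jewel is $$\mathcal D_{\mathbf k}(n)=\Big\{X\in SM_n(\mathbb F)^{N}:\ \sum_{x\in[g]}\sum_{i\in[k_x-1]}\big(I_{k_1}\otimes\cdots\otimes I_{k_{x-1}}\otimes\operatorname{diag}(v_i^{(k_x)})\otimes I_{k_{x+1}}\otimes\cdots\otimes I_{k_g}\big)\otimes X_{i|x}\preceq I\Big\}.$$ Identify $\mathcal D_{\mathbf k}(1)$ with a subset of $\mathbb R^N$ and let $P=\{y\in\mathbb R^N:\langle x,y\rangle\le1\ \ \forall x\in\mathcal D_{\mathbf k}(1)\}$ be its polar dual. Level $n$ of the dual free polytope $\mathcal D_{\mathbf k}^{\square}$ is level $n$ of the maximal matrix convex set over $P$: the set of all $A\in SM_n(\mathbb F)^N$ such that $\sum_{i,x} a_{i|x}A_{i|x}\preceq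 a_0I_n$ whenever $a\in\mathbb R^N$, $a_0\in\mathbb R$ satisfy $\langle a,y\rangle\le a_0$ for all $y\in P$. **Theorem.** The maxima and the minimum defining $s_{\mathbb F}(E)$ and $s_{\mathbb F}(d,g,\mathbf k)$ are attained, $s_{\mathbb F}(d,g,\mathbf k)>0$, and $$\frac1{s_{\mathbb F}(d,g,\mathbf k)}=\max\Big\{\lambda_{\max}\Big(\sum_{x\in[g]}\sum_{i\in[k_x-1]}A_{i|x}\otimes X_{i|x}\Big):\ A\in\mathcal D_{\mathbf k}^{\square}(d),\ X\in\mathcal D_{\mathbf k}(d)\Big\},$$ where $\lambda_{\max}$ denotes the largest eigenvalue and the maximum on the right is attained. -/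

import Mathlib

open scoped Kronecker ComplexOrder

namespace MatrixJewel

/-- A graded set of `ι`-tuples of square matrices over `𝕜`: one set of tuples for each size `n`. -/
abbrev GradedSet (ι 𝕜 : Type*) : Type _ := (n : ℕ) → Set (ι → Matrix (Fin n) (Fin n) 𝕜)

/-- The free spectrahedron defined by the tuple `A`: level `n` consists of the tuples `X` of
self-adjoint `n × n` matrices with `∑ i, A i ⊗ X i ≼ I`. -/
def freeSpectrahedron {ι m 𝕜 : Type*} [Fintype ι] [DecidableEq m] [RCLike 𝕜]
    (A : ι → Matrix m m 𝕜) : GradedSet ι 𝕜 :=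
  fun _ => {X | (∀ i, (X i).IsHermitian) ∧ (1 - ∑ i, A i ⊗ₖ X i).PosSemidef}

/-- The first level of a graded set of self-adjoint tuples, as a subset of `ℝ^ι`. -/
def levelOne {ι 𝕜 : Type*} [RCLike 𝕜] (K : GradedSet ι 𝕜) : Set (ι → ℝ) :=
  {x | (fun i => Matrix.of fun _ _ => (x i : 𝕜)) ∈ K 1}

/-- The polar dual of a subset of `ℝ^ι`. -/
def polarDual {ι : Type*} [Fintype ι] (C : Set (ι → ℝ)) : Set (ι → ℝ) :=
  {y | ∀ x ∈ C, x ⬝ᵥ y ≤ 1}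

/-- The maximal matrix convex set over `C ⊆ ℝ^ι`: the self-adjoint tuples which satisfy all
affine inequalities that are valid on `C`. -/
def maxMatrixConvexSet (𝕜 : Type*) [RCLike 𝕜] {ι : Type*} [Fintype ι] (C : Set (ι → ℝ)) :
    GradedSet ι 𝕜 :=
  fun _ => {X | (∀ i, (X i).IsHermitian) ∧
    ∀ (a : ι → ℝ) (a₀ : ℝ), (∀ x ∈ C, a ⬝ᵥ x ≤ a₀) →
      ((a₀ : 𝕜) • 1 - ∑ i, (a i : 𝕜) • X i).PosSemidef}

/-- The dual free polytope of a free polytope `K`: the maximal matrix convex set over the polar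
dual of the first level of `K`. -/
def dualFreePolytope {ι 𝕜 : Type*} [Fintype ι] [RCLike 𝕜] (K : GradedSet ι 𝕜) :
    GradedSet ι 𝕜 :=
  maxMatrixConvexSet 𝕜 (polarDual (levelOne K))

/-- The index set of the variables `X_{i|x}`, `x ∈ [g]`, `i ∈ [k_x - 1]`. -/
abbrev JewelIndex {g : ℕ} (k : Fin g → ℕ) : Type := (x : Fin g) × Fin (k x - 1)

/-- The vector `v_i^{(k)} ∈ ℝ^k`, with entries `-2/k + 2 δ_{l,i}`. -/
noncomputable def jewelVec (k : ℕ) (i : Fin (k - 1)) (l : Fin k) : ℝ :=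
  -(2 / (k : ℝ)) + 2 * (if l.val = i.val then 1 else 0)

/-- The matrix `I ⊗ ⋯ ⊗ I ⊗ diag (v_i^{(k_x)}) ⊗ I ⊗ ⋯ ⊗ I` with the diagonal factor at
position `x`; rows and columns are indexed by `[k_1] × ⋯ × [k_g]`. -/
noncomputable def jewelMatrix (𝕜 : Type*) [RCLike 𝕜] {g : ℕ} (k : Fin g → ℕ)
    (p : JewelIndex k) : Matrix ((x : Fin g) → Fin (k x)) ((x : Fin g) → Fin (k x)) 𝕜 :=
  Matrix.diagonal fun j => (jewelVec (k p.1) p.2 (j p.1) : 𝕜)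

/-- The matrix jewel with parameters `k = (k_1, …, k_g)`. -/
noncomputable def matrixJewel (𝕜 : Type*) [RCLike 𝕜] {g : ℕ} (k : Fin g → ℕ) :
    GradedSet (JewelIndex k) 𝕜 :=
  freeSpectrahedron (jewelMatrix 𝕜 k)

/-- The largest eigenvalue (of a self-adjoint matrix). -/
noncomputable def lambdaMax {n 𝕜 : Type*} [Fintype n] [DecidableEq n] [RCLike 𝕜]
    (M : Matrix n n 𝕜) : ℝ :=
  sSup {t : ℝ | Module.End.HasEigenvalue (Matrix.toLin' M) (t : 𝕜)}

/-- A measurement (POVM) with outcomes in `σ`. -/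
def IsPOVM {σ n 𝕜 : Type*} [Fintype σ] [DecidableEq n] [RCLike 𝕜]
    (E : σ → Matrix n n 𝕜) : Prop :=
  (∀ i, (E i).PosSemidef) ∧ ∑ i, E i = 1

/-- A tuple of `g` measurements with `k_1, …, k_g` outcomes on a `d`-dimensional space. -/
abbrev MeasTuple (𝕜 : Type*) (d : ℕ) {g : ℕ} (k : Fin g → ℕ) : Type _ :=
  (x : Fin g) → Fin (k x) → Matrix (Fin d) (Fin d) 𝕜

/-- Compatibility: all `E x` are marginals of one joint POVM. -/
def IsCompatible {𝕜 : Type*} [RCLike 𝕜] {d g : ℕ} {k : Fin g → ℕ} (E : MeasTuple 𝕜 d k) : Prop :=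
  ∃ J : ((x : Fin g) → Fin (k x)) → Matrix (Fin d) (Fin d) 𝕜, IsPOVM J ∧
    ∀ (x : Fin g) (i : Fin (k x)), E x i = ∑ j with j x = i, J j

/-- The noisy version `E_{i|x}(s) = s E_{i|x} + (1 - s) I / k_x`. -/
noncomputable def noisy {𝕜 : Type*} [RCLike 𝕜] {d g : ℕ} {k : Fin g → ℕ} (s : ℝ)
    (E : MeasTuple 𝕜 d k) : MeasTuple 𝕜 d k :=
  fun x i => (s : 𝕜) • E x i + (((1 - s) / (k x : ℝ) : ℝ) : 𝕜) • 1

/-- The noise parameters `s ∈ [0,1]` for which the noisy versions are compatible. -/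
def compatParams {𝕜 : Type*} [RCLike 𝕜] {d g : ℕ} {k : Fin g → ℕ} (E : MeasTuple 𝕜 d k) :
    Set ℝ :=
  {s | s ∈ Set.Icc (0 : ℝ) 1 ∧ IsCompatible (noisy s E)}

/-- The compatibility degree of a tuple of measurements. -/
noncomputable def compatDegree {𝕜 : Type*} [RCLike 𝕜] {d g : ℕ} {k : Fin g → ℕ}
    (E : MeasTuple 𝕜 d k) : ℝ :=
  sSup (compatParams E)

/-- The compatibility degrees of all `g`-tuples of measurements over `𝕜` with `k_1, …, k_g`
outcomes in dimension `d`. -/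
def compatDegrees (𝕜 : Type*) [RCLike 𝕜] (d : ℕ) {g : ℕ} (k : Fin g → ℕ) : Set ℝ :=
  {t | ∃ E : MeasTuple 𝕜 d k, (∀ x, IsPOVM (E x)) ∧ t = compatDegree E}

/-- The minimum compatibility degree `s_𝕜(d, g, (k_1, …, k_g))`. -/
noncomputable def minCompatDegree (𝕜 : Type*) [RCLike 𝕜] (d : ℕ) {g : ℕ} (k : Fin g → ℕ) : ℝ :=
  sInf (compatDegrees 𝕜 d k)

/-- `lambdaMax` is attained, hence really the largest eigenvalue, for self-adjoint matrices of
positive size. -/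
theorem isGreatest_lambdaMax {n 𝕜 : Type*} [Fintype n] [DecidableEq n] [Nonempty n] [RCLike 𝕜]
    {M : Matrix n n 𝕜} (hM : M.IsHermitian) :
    IsGreatest {t : ℝ | Module.End.HasEigenvalue (Matrix.toLin' M) (t : 𝕜)} (lambdaMax M) := by
  have hfin : {t : ℝ | Module.End.HasEigenvalue (Matrix.toLin' M) (t : 𝕜)}.Finite :=
    (Module.End.finite_hasEigenvalue (Matrix.toLin' M)).preimage
      (RCLike.ofReal_injective.injOn)
  have hne : {t : ℝ | Module.End.HasEigenvalue (Matrix.toLin' M) (t : 𝕜)}.Nonempty := by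
    obtain ⟨i⟩ := ‹Nonempty n›
    refine ⟨hM.eigenvalues i, Module.End.hasEigenvalue_of_hasEigenvector
      (x := (hM.eigenvectorBasis i).ofLp) ?_⟩
    rw [Module.End.hasEigenvector_iff, Module.End.mem_eigenspace_iff]
    refine ⟨?_, fun h => hM.eigenvectorBasis.orthonormal.ne_zero i ?_⟩
    · rw [Matrix.toLin'_apply, hM.mulVec_eigenvectorBasis i]
      ext j
      simp [RCLike.real_smul_eq_coe_mul]
    · ext j
      simpa using congrFun h j
  exact ⟨hne.csSup_mem hfin, fun t ht => le_csSup hfin.bddAbove ht⟩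

open scoped MatrixOrder Matrix.Norms.L2Operator in
/-- For real measurements it does not matter whether the joint measurement is asked to be real
or is allowed to be complex. -/
theorem isCompatible_real_iff {d g : ℕ} {k : Fin g → ℕ} (E : MeasTuple ℝ d k) :
    IsCompatible E ↔
      IsCompatible (𝕜 := ℂ) (fun x i => (E x i).map (fun r : ℝ => (r : ℂ))) := by
  constructor
  · rintro ⟨J, ⟨hJ, hJ1⟩, h⟩
    refine ⟨fun j => (J j).map (fun r : ℝ => (r : ℂ)), ⟨fun j => ?_, ?_⟩, fun x i => ?_⟩
    · obtain ⟨B, hB⟩ := CStarAlgebra.nonneg_iff_eq_star_mul_self.mp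
        (Matrix.nonneg_iff_posSemidef.mpr (hJ j))
      have hB' : (J j).map (fun r : ℝ => (r : ℂ)) =
          (B.map (fun r : ℝ => (r : ℂ))).conjTranspose * B.map (fun r : ℝ => (r : ℂ)) := by
        rw [hB]
        ext a b
        simp [Matrix.mul_apply, Matrix.star_eq_conjTranspose]
      change ((J j).map (fun r : ℝ => (r : ℂ))).PosSemidef
      rw [hB']
      exact Matrix.posSemidef_conjTranspose_mul_self _
    · ext a b
      have := congrFun (congrFun hJ1 a) b
      simp only [Matrix.sum_apply, Matrix.map_apply] at this ⊢
      rw [← Complex.ofReal_sum, this]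
      by_cases hab : a = b <;> simp [Matrix.one_apply, hab]
    · ext a b
      simp [h x i, Matrix.sum_apply]
  · rintro ⟨J, ⟨hJ, hJ1⟩, h⟩
    refine ⟨fun j => (J j).map Complex.re, ⟨fun j => ?_, ?_⟩, fun x i => ?_⟩
    · refine Matrix.PosSemidef.of_dotProduct_mulVec_nonneg ?_ fun v => ?_
      · ext a b
        have := congrArg Complex.re (congrFun (congrFun (hJ j).1 a) b)
        simpa using this
      · have h0 := (Complex.le_def.mp ((hJ j).dotProduct_mulVec_nonneg (fun a => (v a : ℂ)))).1
        simpa [dotProduct, Matrix.mulVec] using h0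
    · ext a b
      have := congrArg Complex.re (congrFun (congrFun hJ1 a) b)
      simp only [Matrix.sum_apply, Matrix.map_apply, Complex.re_sum] at this ⊢
      rw [this]
      by_cases hab : a = b <;> simp [Matrix.one_apply, hab]
    · ext a b
      have := congrArg Complex.re (congrFun (congrFun (h x i) a) b)
      simpa [Matrix.sum_apply] using this

end MatrixJewel

open MatrixJewel

/-! Put `A_{i|x} = 2 E_{i|x} - (2/k_x) I`. This is a bijection between tuples of measurements and
level `d` of the dual free polytope: the facets of `P` are exactly positivity of the effects, the
last effect being fixed by normalisation (`jewelTuple_mem_dualFreePolytope`,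
`exists_eq_jewelTuple_of_mem_dualFreePolytope`). Trivial measurements go to `0`, so adding noise is
multiplication by `s`.

A joint measurement `J` exists iff `s A = ∑ j, w_j ⊗ J_j`, where `w_j` are the vertices of `P`, i.e.
the rows of the diagonal jewel matrices (`isCompatible_noisy_iff`). By duality this is equivalent to
`s ∑ A ⊗ X ≼ I` for all `X` in level `d` of the jewel. One direction is the identity `I - s ∑ A ⊗ X
= ∑ j, J_j ⊗ (I - ∑ w_j X)`. The other, `exists_isPOVM_of_forall_posSemidef`, separates by
Hahn–Banach and normalises the separating tuple into an element of the jewel of the same size.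

Both levels are compact, so the pairing has a maximum `m`, and `m ≥ 1` by an explicit pair. Then
`1/m` is admissible for every `E`, and the `E` belonging to a maximising `A` admits nothing larger.
-/

namespace MatrixJewel

/-! ### Positive semidefinite matrices: entry bounds, compactness, largest eigenvalue -/

section Basic

theorem isCompact_of_isClosed_of_norm_apply_le {ι n 𝕜 : Type*} [RCLike 𝕜]
    {S : Set (ι → Matrix n n 𝕜)}
    (hS : IsClosed S) (c : ℝ) (hc : ∀ X ∈ S, ∀ p i j, ‖X p i j‖ ≤ c) : IsCompact S := by
  have hK : IsCompact (Set.univ.pi fun _ : ι => Set.univ.pi fun _ : n => Set.univ.pi fun _ : n =>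
      Metric.closedBall (0 : 𝕜) c) :=
    isCompact_univ_pi fun _ => isCompact_univ_pi fun _ => isCompact_univ_pi fun _ =>
      isCompact_closedBall _ _
  refine IsCompact.of_isClosed_subset hK hS fun X hX => ?_
  exact fun p _ i _ j _ => mem_closedBall_zero_iff.mpr (hc X hX p i j)

variable {n 𝕜 : Type*} [Fintype n] [RCLike 𝕜]

theorem isClosed_posSemidef : IsClosed {M : Matrix n n 𝕜 | M.PosSemidef} := by
  simp only [Matrix.posSemidef_iff_dotProduct_mulVec, Set.ofPred_and, Set.ofPred_forall]
  refine IsClosed.inter ?_ (isClosed_iInter fun v => ?_)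
  · exact isClosed_eq (Continuous.matrix_conjTranspose continuous_id) continuous_id
  · exact isClosed_le continuous_const (by fun_prop)

-- With `M = B* B`, the entry `M i j` is an inner product of two columns of `B`, so it is at most
-- the mean of their squared norms, each of which is at most the trace.
open scoped MatrixOrder Matrix.Norms.L2Operator in
theorem norm_apply_le_re_trace [DecidableEq n] {M : Matrix n n 𝕜} (hM : M.PosSemidef) (i j : n) :
    ‖M i j‖ ≤ RCLike.re M.trace := by
  obtain ⟨B, hB⟩ := CStarAlgebra.nonneg_iff_eq_star_mul_self.mp
    (Matrix.nonneg_iff_posSemidef.mpr hM)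
  have htr : RCLike.re M.trace = ∑ a, ∑ l, ‖B l a‖ ^ 2 := by
    simp only [hB, Matrix.trace, Matrix.diag, Matrix.mul_apply, Matrix.star_apply, map_sum]
    refine Finset.sum_congr rfl fun a _ => Finset.sum_congr rfl fun l _ => ?_
    rw [RCLike.star_def, RCLike.conj_mul]
    norm_cast
  have hle : ∀ a, ∑ l, ‖B l a‖ ^ 2 ≤ RCLike.re M.trace := fun a => by
    rw [htr]
    exact Finset.single_le_sum (f := fun a => ∑ l, ‖B l a‖ ^ 2)
      (fun a _ => Finset.sum_nonneg fun l _ => sq_nonneg _) (Finset.mem_univ a)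
  have hij : ‖M i j‖ ≤ ∑ l, ‖B l i‖ * ‖B l j‖ := by
    rw [hB, Matrix.mul_apply]
    refine (norm_sum_le _ _).trans (Finset.sum_le_sum fun l _ => ?_)
    simp [Matrix.star_apply]
  have h2 : ∑ l, ‖B l i‖ * ‖B l j‖ ≤ ∑ l, (‖B l i‖ ^ 2 + ‖B l j‖ ^ 2) / 2 :=
    Finset.sum_le_sum fun l _ => by nlinarith [sq_nonneg (‖B l i‖ - ‖B l j‖)]
  rw [← Finset.sum_div, Finset.sum_add_distrib] at h2
  linarith [hle i, hle j]

/-- For self-adjoint `M`, the inequality `M ≼ c I` in terms of the quadratic form. -/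
theorem posSemidef_smul_one_sub_iff [DecidableEq n] {M : Matrix n n 𝕜} (hM : M.IsHermitian)
    (c : ℝ) : ((c : 𝕜) • 1 - M).PosSemidef ↔
      ∀ v : n → 𝕜, RCLike.re (star v ⬝ᵥ M.mulVec v) ≤ c * RCLike.re (star v ⬝ᵥ v) := by
  have hH : ((c : 𝕜) • 1 - M).IsHermitian := by
    refine Matrix.IsHermitian.sub ?_ hM
    simp [Matrix.IsHermitian, Matrix.conjTranspose_smul]
  have key : ∀ v : n → 𝕜, RCLike.re (star v ⬝ᵥ ((c : 𝕜) • 1 - M).mulVec v) =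
      c * RCLike.re (star v ⬝ᵥ v) - RCLike.re (star v ⬝ᵥ M.mulVec v) := fun v => by
    simp [Matrix.sub_mulVec, Matrix.smul_mulVec, dotProduct_sub, RCLike.smul_re]
  constructor
  · intro h v
    have := h.re_dotProduct_nonneg v
    rw [key] at this
    linarith
  · intro h
    refine Matrix.PosSemidef.of_dotProduct_mulVec_nonneg hH fun v => ?_
    rw [RCLike.nonneg_iff]
    refine ⟨?_, hH.im_star_dotProduct_mulVec_self v⟩
    rw [key]
    linarith [h v]

theorem re_trace_le_of_posSemidef_sub [DecidableEq n] {M N : Matrix n n 𝕜}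
    (h : (N - M).PosSemidef) : RCLike.re M.trace ≤ RCLike.re N.trace := by
  have := (RCLike.nonneg_iff.mp h.trace_nonneg).1
  rw [Matrix.trace_sub, map_sub] at this
  linarith

/-- The matrix `c I + M` is positive semidefinite with trace at most `2 c n`, so the trace bounds
its entries; subtracting `c I` costs another `c`. -/
theorem norm_apply_le_of_le_of_le [DecidableEq n] {M : Matrix n n 𝕜} {c : ℝ} (hc : 0 ≤ c)
    (h₁ : ((c : 𝕜) • 1 - M).PosSemidef) (h₂ : ((c : 𝕜) • 1 + M).PosSemidef) (i j : n) :
    ‖M i j‖ ≤ 2 * c * Fintype.card n + c := by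
  have h3 := norm_apply_le_re_trace h₂ i j
  have h4 : RCLike.re ((c : 𝕜) • 1 + M).trace ≤ 2 * c * Fintype.card n := by
    have := re_trace_le_of_posSemidef_sub h₁
    simp only [Matrix.trace_add, Matrix.trace_smul, Matrix.trace_one, map_add, smul_eq_mul,
      RCLike.re_ofReal_mul, RCLike.natCast_re] at this ⊢
    linarith
  have h5 : ‖((c : 𝕜) • (1 : Matrix n n 𝕜)) i j‖ ≤ c := by
    by_cases hij : i = j <;> simp [hij, abs_of_nonneg hc, hc]
  have h6 : M i j = ((c : 𝕜) • 1 + M) i j - ((c : 𝕜) • (1 : Matrix n n 𝕜)) i j := by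
    rw [Matrix.add_apply, add_sub_cancel_left]
  rw [h6]
  exact (norm_sub_le _ _).trans (by linarith)

theorem isCompact_unit_vectors : IsCompact {v : n → 𝕜 | star v ⬝ᵥ v = 1} := by
  have hK : IsCompact (Set.univ.pi fun _ : n => Metric.closedBall (0 : 𝕜) 1) :=
    isCompact_univ_pi fun _ => isCompact_closedBall _ _
  refine IsCompact.of_isClosed_subset hK (isClosed_eq (by fun_prop) continuous_const) fun v hv => ?_
  simp only [Set.mem_pi, Set.mem_univ, forall_const, mem_closedBall_zero_iff]
  intro i
  have h1 : ∑ a, ‖v a‖ ^ 2 = 1 := by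
    have := congrArg RCLike.re (show star v ⬝ᵥ v = 1 from hv)
    simp only [dotProduct, Pi.star_apply, RCLike.star_def, RCLike.conj_mul, map_sum,
      RCLike.one_re] at this
    rw [← this]
    exact Finset.sum_congr rfl fun a _ => by norm_cast
  have h2 := Finset.single_le_sum (f := fun a => ‖v a‖ ^ 2) (fun a _ => sq_nonneg _)
    (Finset.mem_univ i)
  rw [h1] at h2
  exact (sq_le_one_iff₀ (norm_nonneg _)).mp h2

theorem exists_ne_zero_eigenvector_lambdaMax [DecidableEq n] [Nonempty n] {M : Matrix n n 𝕜}
    (hM : M.IsHermitian) : ∃ v : n → 𝕜, v ≠ 0 ∧ M.mulVec v = (lambdaMax M : 𝕜) • v := by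
  obtain ⟨v, hv⟩ := (isGreatest_lambdaMax hM).1.exists_hasEigenvector
  refine ⟨v, hv.2, ?_⟩
  simpa using hv.apply_eq_smul

/-- Makes `lambdaMax` a value of a jointly continuous form, so that its maximum follows from
compactness without continuity of eigenvalues. -/
theorem exists_unit_vector_lambdaMax [DecidableEq n] [Nonempty n] {M : Matrix n n 𝕜}
    (hM : M.IsHermitian) :
    ∃ v : n → 𝕜, star v ⬝ᵥ v = 1 ∧ RCLike.re (star v ⬝ᵥ M.mulVec v) = lambdaMax M := by
  obtain ⟨v, hv0, hv⟩ := exists_ne_zero_eigenvector_lambdaMax hM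
  obtain ⟨r, hr⟩ : ∃ r : ℝ, star v ⬝ᵥ v = (r : 𝕜) :=
    ⟨∑ a, ‖v a‖ ^ 2, by simp [dotProduct, RCLike.conj_mul]⟩
  have hpos : 0 < r := by
    have h := Matrix.dotProduct_star_self_pos_iff.mpr hv0
    rw [hr] at h
    exact_mod_cast h
  have hs : (Real.sqrt r)⁻¹ * ((Real.sqrt r)⁻¹ * r) = 1 := by
    rw [← mul_assoc, ← mul_inv, Real.mul_self_sqrt hpos.le, inv_mul_cancel₀ hpos.ne']
  have h1 : star (((Real.sqrt r)⁻¹ : ℝ) • v) ⬝ᵥ (((Real.sqrt r)⁻¹ : ℝ) • v) = (1 : 𝕜) := by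
    rw [star_smul, smul_dotProduct, dotProduct_smul, hr, star_trivial,
      RCLike.real_smul_eq_coe_mul, RCLike.real_smul_eq_coe_mul, ← RCLike.ofReal_mul,
      ← RCLike.ofReal_mul, hs, RCLike.ofReal_one]
  refine ⟨((Real.sqrt r)⁻¹ : ℝ) • v, h1, ?_⟩
  rw [Matrix.mulVec_smul, hv, smul_comm, dotProduct_smul, h1]
  simp

/-- An eigenvalue `μ` of `lambdaMax M • 1 - M` makes `lambdaMax M - μ` an eigenvalue of `M`;
maximality forces `μ ≥ 0`. -/
theorem posSemidef_lambdaMax_smul_one_sub [DecidableEq n] [Nonempty n] {M : Matrix n n 𝕜}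
    (hM : M.IsHermitian) : ((lambdaMax M : 𝕜) • 1 - M).PosSemidef := by
  have hH : ((lambdaMax M : 𝕜) • 1 - M).IsHermitian := by
    refine Matrix.IsHermitian.sub ?_ hM
    simp [Matrix.IsHermitian, Matrix.conjTranspose_smul]
  rw [hH.posSemidef_iff_eigenvalues_nonneg]
  intro i
  have hv := hH.mulVec_eigenvectorBasis i
  set v : n → 𝕜 := (hH.eigenvectorBasis i).ofLp with hvdef
  have hv0 : v ≠ 0 := fun h => hH.eigenvectorBasis.orthonormal.ne_zero i (by
    ext j
    exact congrFun h j)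
  have hMv : M.mulVec v = ((lambdaMax M - hH.eigenvalues i : ℝ) : 𝕜) • v := by
    rw [Matrix.sub_mulVec, Matrix.smul_mulVec, Matrix.one_mulVec, RCLike.real_smul_eq_coe_smul
      (K := 𝕜)] at hv
    rw [RCLike.ofReal_sub, sub_smul, ← hv]
    abel
  have := (isGreatest_lambdaMax hM).2 (show (lambdaMax M - hH.eigenvalues i) ∈
    {t : ℝ | Module.End.HasEigenvalue (Matrix.toLin' M) (t : 𝕜)} from
    Module.End.hasEigenvalue_of_hasEigenvector (x := v) (by
      rw [Module.End.hasEigenvector_iff, Module.End.mem_eigenspace_iff]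
      exact ⟨by rw [Matrix.toLin'_apply, hMv], hv0⟩))
  simp only [Pi.zero_apply]
  linarith

theorem re_dotProduct_mulVec_le_lambdaMax [DecidableEq n] [Nonempty n] {M : Matrix n n 𝕜}
    (hM : M.IsHermitian) {v : n → 𝕜} (hv : star v ⬝ᵥ v = 1) :
    RCLike.re (star v ⬝ᵥ M.mulVec v) ≤ lambdaMax M := by
  have := (posSemidef_smul_one_sub_iff hM _).mp (posSemidef_lambdaMax_smul_one_sub hM) v
  simpa [hv] using this

end Basic

/-! ### Separation and duality with free spectrahedra of diagonal tuples -/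

section Duality

variable {ι κ σ n 𝕜 : Type*} [RCLike 𝕜]

theorem sum_sum_mul_conjTranspose_re [Fintype n] {H : Matrix n n 𝕜} (hH : H.IsHermitian)
    (F : Matrix n n 𝕜) :
    RCLike.re (∑ a, ∑ b, H a b * F.conjTranspose a b) = RCLike.re (∑ a, ∑ b, H a b * F a b) := by
  rw [← RCLike.conj_re, map_sum, Finset.sum_comm]
  simp only [map_sum, map_mul]
  refine Finset.sum_congr rfl fun a _ => Finset.sum_congr rfl fun b _ => ?_
  rw [Matrix.conjTranspose_apply, ← RCLike.star_def, star_star, hH.apply]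

/-- Linear functionals on tuples of matrices are represented on self-adjoint tuples by
self-adjoint tuples. -/
theorem exists_isHermitian_re_eq [Fintype κ] [Fintype n]
    (f : (κ → n → n → 𝕜) →ₗ[𝕜] 𝕜) :
    ∃ G : κ → Matrix n n 𝕜, (∀ p, (G p).IsHermitian) ∧
      ∀ H : κ → Matrix n n 𝕜, (∀ p, (H p).IsHermitian) →
        RCLike.re (f H) = ∑ p, RCLike.re (∑ a, ∑ b, H p a b * G p a b) := by
  classical
  let F : κ → Matrix n n 𝕜 := fun p => Matrix.of fun a b =>
    f (Pi.single p (Pi.single a (Pi.single b 1)))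
  have hf : ∀ H : κ → n → n → 𝕜, f H = ∑ p, ∑ a, ∑ b, H p a b * F p a b := fun H => by
    have h1 : H = ∑ p, ∑ a, ∑ b, H p a b •
        (Pi.single p (Pi.single a (Pi.single b (1 : 𝕜))) : κ → n → n → 𝕜) := by
      ext p a b
      simp only [Finset.sum_apply, Pi.smul_apply, smul_eq_mul]
      rw [Finset.sum_eq_single p, Finset.sum_eq_single a, Finset.sum_eq_single b]
      · simp
      all_goals simp +contextual [Pi.single_apply, eq_comm]
    conv_lhs => rw [h1]
    simp [F]
  -- Taking the Hermitian part of the coefficient matrix is harmless: against a Hermitian `H`,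
  -- pairing with `F` and with its adjoint have the same real part.
  refine ⟨fun p => ((1 / 2 : ℝ) : 𝕜) • (F p + (F p).conjTranspose), fun p => ?_, fun H hH => ?_⟩
  · simp [Matrix.IsHermitian, Matrix.conjTranspose_smul, Matrix.conjTranspose_add, add_comm]
  · refine (congrArg RCLike.re (hf H)).trans ?_
    rw [map_sum]
    refine Finset.sum_congr rfl fun p _ => ?_
    have h1 := sum_sum_mul_conjTranspose_re (hH p) (F p)
    have h2 : ∑ a, ∑ b, H p a b *
        (((1 / 2 : ℝ) : 𝕜) • (F p + (F p).conjTranspose)) a b =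
        ((1 / 2 : ℝ) : 𝕜) * (∑ a, ∑ b, H p a b * F p a b +
          ∑ a, ∑ b, H p a b * (F p).conjTranspose a b) := by
      rw [← Finset.sum_add_distrib, Finset.mul_sum]
      refine Finset.sum_congr rfl fun a _ => ?_
      rw [← Finset.sum_add_distrib, Finset.mul_sum]
      refine Finset.sum_congr rfl fun b _ => ?_
      rw [Matrix.smul_apply, Matrix.add_apply, smul_eq_mul]
      ring
    rw [h2, RCLike.re_ofReal_mul, map_add, h1]
    ring

theorem re_trace_le_sum_re_trace [Fintype σ] [Fintype n] {J : σ → Matrix n n 𝕜}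
    (hJ : ∀ j, (J j).PosSemidef) (j : σ) :
    RCLike.re (J j).trace ≤ ∑ j, RCLike.re (J j).trace :=
  Finset.single_le_sum (f := fun j => RCLike.re (J j).trace)
    (fun j _ => (RCLike.nonneg_iff.mp (hJ j).trace_nonneg).1) (Finset.mem_univ j)

theorem isCompact_posSemidef_trace_eq [Fintype σ] [Fintype n] (c : ℝ) :
    IsCompact {J : σ → Matrix n n 𝕜 |
      (∀ j, (J j).PosSemidef) ∧ ∑ j, RCLike.re (J j).trace = c} := by
  classical
  refine isCompact_of_isClosed_of_norm_apply_le ?_ c fun J hJ p a b => ?_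
  · simp only [Set.ofPred_and, Set.ofPred_forall]
    refine IsClosed.inter (isClosed_iInter fun j => ?_) (isClosed_eq ?_ continuous_const)
    · have hj : Continuous fun J : σ → Matrix n n 𝕜 => J j := continuous_apply j
      exact isClosed_posSemidef.preimage hj
    · exact continuous_finsetSum _ fun j _ => RCLike.continuous_re.comp
        ((continuous_apply j).matrix_trace)
  · exact (norm_apply_le_re_trace (hJ.1 p) a b).trans
      ((re_trace_le_sum_re_trace hJ.1 p).trans hJ.2.le)

/-- The pairing `∑ H a b * G a b` involves no transpose, which is why the conjugated rank-one matrix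
is the one that yields the quadratic form of `G`. -/
theorem sum_sum_vecMulVec_mul [Fintype n] (v : n → 𝕜) (G : Matrix n n 𝕜) :
    ∑ a, ∑ b, Matrix.vecMulVec (star v) v a b * G a b = star v ⬝ᵥ G.mulVec v := by
  simp only [dotProduct, Matrix.mulVec, Matrix.vecMulVec_apply, Finset.mul_sum]
  refine Finset.sum_congr rfl fun a _ => Finset.sum_congr rfl fun b _ => ?_
  ring

/-- Separation of a self-adjoint tuple `B` from the tuples `∑ j, u j ⊗ J j` with `J j ≽ 0` and
total trace `c`. -/
theorem exists_separating_tuple [Fintype κ] [Fintype σ] [Fintype n] [DecidableEq n]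
    (u : σ → κ → ℝ) {B : κ → Matrix n n 𝕜} (hB : ∀ p, (B p).IsHermitian) {c : ℝ} (hc : 0 < c)
    (hsep : ¬ ∃ J : σ → Matrix n n 𝕜, (∀ j, (J j).PosSemidef) ∧
      ∑ j, RCLike.re (J j).trace = c ∧ ∀ p, B p = ∑ j, (u j p : 𝕜) • J j) :
    ∃ (G : κ → Matrix n n 𝕜) (t : ℝ), (∀ p, (G p).IsHermitian) ∧
      (∀ j, ((t : 𝕜) • 1 - ∑ p, (u j p : 𝕜) • G p).PosDef) ∧
      t * c < ∑ p, RCLike.re (∑ a, ∑ b, B p a b * G p a b) := by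
  classical
  let S : Set (σ → Matrix n n 𝕜) := {J | (∀ j, (J j).PosSemidef) ∧
    ∑ j, RCLike.re (J j).trace = c}
  let L : (σ → Matrix n n 𝕜) → (κ → n → n → 𝕜) := fun J p => ∑ j, (u j p : 𝕜) • J j
  have hLc : Continuous L := by
    refine continuous_pi fun p => ?_
    refine continuous_finsetSum (M := Matrix n n 𝕜) _ fun j _ => ?_
    have hj : Continuous fun J : σ → Matrix n n 𝕜 => J j := continuous_apply j
    exact hj.const_smul (u j p : 𝕜)
  have hcomp : IsCompact (L '' S) := (isCompact_posSemidef_trace_eq c).image hLc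
  have hconv : Convex ℝ (L '' S) := by
    rintro _ ⟨J, hJ, rfl⟩ _ ⟨J', hJ', rfl⟩ a b ha hb hab
    refine ⟨fun j => (a : 𝕜) • J j + (b : 𝕜) • J' j, ⟨fun j => ?_, ?_⟩, ?_⟩
    · exact ((hJ.1 j).smul (by exact_mod_cast ha)).add ((hJ'.1 j).smul (by exact_mod_cast hb))
    · simp only [Matrix.trace_add, Matrix.trace_smul, smul_eq_mul, map_add, RCLike.re_ofReal_mul,
        Finset.sum_add_distrib, ← Finset.mul_sum, hJ.2, hJ'.2]
      rw [← add_mul, hab, one_mul]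
    · ext p i l
      change (∑ j, (u j p : 𝕜) • ((a : 𝕜) • J j + (b : 𝕜) • J' j)) i l =
        a • (∑ j, (u j p : 𝕜) • J j) i l + b • (∑ j, (u j p : 𝕜) • J' j) i l
      simp only [Matrix.sum_apply, Matrix.smul_apply, Matrix.add_apply, smul_eq_mul,
        RCLike.real_smul_eq_coe_mul, Finset.mul_sum, ← Finset.sum_add_distrib]
      exact Finset.sum_congr rfl fun j _ => by ring
  have hBL : (B : κ → n → n → 𝕜) ∉ L '' S := by
    rintro ⟨J, hJ, h⟩
    exact hsep ⟨J, hJ.1, hJ.2, fun p => (congrFun h p).symm⟩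
  obtain ⟨f, s, hfs, hsB⟩ := RCLike.geometric_hahn_banach_closed_point (𝕜 := 𝕜) hconv
    hcomp.isClosed hBL
  obtain ⟨G, hG, hfG⟩ := exists_isHermitian_re_eq f.toLinearMap
  -- Elements of `S` have total trace `c`, so the bound `s` for `f` becomes `s / c` per unit of
  -- trace.
  refine ⟨G, s / c, hG, fun j => ?_, ?_⟩
  · have hHerm : (((s / c : ℝ) : 𝕜) • 1 - ∑ p, (u j p : 𝕜) • G p).IsHermitian := by
      simp only [Matrix.IsHermitian, Matrix.conjTranspose_sub, Matrix.conjTranspose_smul,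
        Matrix.conjTranspose_sum, Matrix.conjTranspose_one, RCLike.star_def, RCLike.conj_ofReal]
      congr 1
      exact Finset.sum_congr rfl fun p _ => by rw [(hG p).eq]
    refine Matrix.PosDef.of_dotProduct_mulVec_pos hHerm fun v hv => ?_
    obtain ⟨r, hr⟩ : ∃ r : ℝ, star v ⬝ᵥ v = (r : 𝕜) :=
      ⟨∑ a, ‖v a‖ ^ 2, by simp [dotProduct, RCLike.conj_mul]⟩
    have hpos : 0 < r := by
      have h := Matrix.dotProduct_star_self_pos_iff.mpr hv
      rw [hr] at h
      exact_mod_cast h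
    have hP := Matrix.posSemidef_vecMulVec_star_self v
    have htr : (Matrix.vecMulVec (star v) v).trace = (r : 𝕜) := by
      rw [Matrix.trace_vecMulVec, hr]
    -- A rank-one matrix of trace `c` placed at the single index `j` isolates the inequality for
    -- that `j`.
    let J : σ → Matrix n n 𝕜 :=
      Pi.single j (((c / r : ℝ) : 𝕜) • Matrix.vecMulVec (star v) v)
    have hJS : J ∈ S := by
      refine ⟨fun j' => ?_, ?_⟩
      · by_cases h : j' = j
        · subst h
          simp only [J, Pi.single_eq_same]
          exact hP.smul (by exact_mod_cast (div_pos hc hpos).le)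
        · simp only [J, Pi.single_eq_of_ne h]
          exact Matrix.PosSemidef.zero
      · rw [Finset.sum_eq_single j]
        · simp only [J, Pi.single_eq_same, Matrix.trace_smul, htr, smul_eq_mul,
            RCLike.re_ofReal_mul, RCLike.ofReal_re]
          field_simp
        · intro j' _ h
          simp [J, Pi.single_eq_of_ne h]
        · simp
    have hLJ : ∀ p, (L J p : Matrix n n 𝕜) =
        ((u j p * (c / r) : ℝ) : 𝕜) • Matrix.vecMulVec (star v) v := fun p => by
      change ∑ j', (u j' p : 𝕜) • J j' = _
      rw [Finset.sum_eq_single j]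
      · simp only [J, Pi.single_eq_same, smul_smul, RCLike.ofReal_mul]
      · intro j' _ h
        simp [J, Pi.single_eq_of_ne h]
      · simp
    have hLJH : ∀ p, Matrix.IsHermitian (L J p) := fun p => by
      rw [hLJ, Matrix.IsHermitian, Matrix.conjTranspose_smul, hP.1.eq]
      simp
    have hlt := hfs _ ⟨J, hJS, rfl⟩
    rw [show f (L J) = f.toLinearMap (L J) from rfl, hfG _ hLJH] at hlt
    have hval : ∀ p, RCLike.re (∑ a, ∑ b, L J p a b * G p a b) =
        c / r * (u j p * RCLike.re (star v ⬝ᵥ (G p).mulVec v)) := fun p => by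
      rw [← sum_sum_vecMulVec_mul, ← mul_assoc, mul_comm (c / r), ← RCLike.re_ofReal_mul]
      simp only [Finset.mul_sum]
      congr 1
      refine Finset.sum_congr rfl fun a _ => Finset.sum_congr rfl fun b _ => ?_
      rw [show L J p a b = _ from congrFun (congrFun (hLJ p) a) b, Matrix.smul_apply, smul_eq_mul,
        mul_assoc]
    simp only [hval, ← Finset.mul_sum] at hlt
    rw [RCLike.pos_iff]
    refine ⟨?_, hHerm.im_star_dotProduct_mulVec_self v⟩
    have hform : RCLike.re (star v ⬝ᵥ
        (((s / c : ℝ) : 𝕜) • 1 - ∑ p, (u j p : 𝕜) • G p).mulVec v) =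
        s / c * r - ∑ p, u j p * RCLike.re (star v ⬝ᵥ (G p).mulVec v) := by
      rw [Matrix.sub_mulVec, dotProduct_sub, map_sub, Matrix.smul_mulVec, Matrix.one_mulVec,
        dotProduct_smul, hr, Matrix.sum_mulVec, dotProduct_sum, map_sum, smul_eq_mul,
        RCLike.re_ofReal_mul, RCLike.ofReal_re]
      congr 1
      refine Finset.sum_congr rfl fun p _ => ?_
      rw [Matrix.smul_mulVec, dotProduct_smul, smul_eq_mul, RCLike.re_ofReal_mul]
    rw [hform, sub_pos]
    rw [div_mul_eq_mul_div, div_lt_iff₀ hpos] at hlt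
    rw [div_mul_eq_mul_div, lt_div_iff₀ hc]
    linarith
  · rw [div_mul_cancel₀ _ hc.ne', ← hfG B hB]
    exact hsB

open scoped MatrixOrder Matrix.Norms.L2Operator in
theorem exists_isUnit_eq_conjTranspose_mul_self [Fintype n] [DecidableEq n] {Z : Matrix n n 𝕜}
    (hZ : Z.PosDef) : ∃ C : Matrix n n 𝕜, IsUnit C.det ∧ Z = C.conjTranspose * C := by
  obtain ⟨C, hC⟩ := CStarAlgebra.nonneg_iff_eq_star_mul_self.mp
    (Matrix.nonneg_iff_posSemidef.mpr hZ.posSemidef)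
  refine ⟨C, ?_, hC⟩
  have h := (Matrix.isUnit_iff_isUnit_det _).mp hZ.isUnit
  rw [hC, Matrix.det_mul] at h
  exact isUnit_of_mul_isUnit_right h

/-- Reading `C` as a vector turns the quadratic form of `B ⊗ X` into the pairing of `B` with `C* X
C`. This is why testing `X` of the same size as `B` suffices. -/
theorem dotProduct_kronecker_mulVec [Fintype n] (B X C : Matrix n n 𝕜) :
    star (fun q : n × n => C q.2 q.1) ⬝ᵥ (B ⊗ₖ X).mulVec (fun q : n × n => C q.2 q.1) =
      ∑ a, ∑ b, B a b * (C.conjTranspose * X * C) a b := by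
  simp only [dotProduct, Matrix.mulVec, Matrix.kroneckerMap_apply, Fintype.sum_prod_type,
    Matrix.mul_apply, Matrix.conjTranspose_apply, Pi.star_apply, Finset.mul_sum, Finset.sum_mul]
  refine Finset.sum_congr rfl fun a _ => ?_
  rw [Finset.sum_comm]
  refine Finset.sum_congr rfl fun b _ => ?_
  rw [Finset.sum_comm]
  refine Finset.sum_congr rfl fun e _ => Finset.sum_congr rfl fun h _ => ?_
  ring

/-- A self-adjoint tuple `B` which satisfies `∑ p, B p ⊗ X p ≼ I` for all `X` (of the same size)
in the free spectrahedron of the diagonal tuple with rows `w j` has the form `∑ j, w j ⊗ J j` for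
a POVM `J`. -/
theorem exists_isPOVM_of_forall_posSemidef [Fintype ι] [Fintype σ] [Nonempty σ] [Fintype n]
    [DecidableEq n] [Nonempty n] (w : σ → ι → ℝ) (hw : ∀ p, ∑ j, w j p = 0)
    {B : ι → Matrix n n 𝕜} (hB : ∀ p, (B p).IsHermitian)
    (h : ∀ X : ι → Matrix n n 𝕜, (∀ p, (X p).IsHermitian) →
      (∀ j, (1 - ∑ p, (w j p : 𝕜) • X p).PosSemidef) → (1 - ∑ p, B p ⊗ₖ X p).PosSemidef) :
    ∃ J : σ → Matrix n n 𝕜, IsPOVM J ∧ ∀ p, B p = ∑ j, (w j p : 𝕜) • J j := by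
  by_contra hcon
  -- The extra coordinate `none`, with weight `1` and target `I`, encodes `∑ j, J j = 1`; the trace
  -- constraint is then `c = n`.
  let u : σ → Option ι → ℝ := fun j p => p.elim 1 (w j)
  let B' : Option ι → Matrix n n 𝕜 := fun p => p.elim 1 B
  have hB' : ∀ p, (B' p).IsHermitian := by
    rintro (_ | p)
    · exact Matrix.isHermitian_one
    · exact hB p
  have hc : (0 : ℝ) < Fintype.card n := by exact_mod_cast Fintype.card_pos
  obtain ⟨G, t, hG, hpos, hlt⟩ := exists_separating_tuple u hB' hc (by
    rintro ⟨J, hJ, -, hJB⟩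
    refine hcon ⟨J, ⟨hJ, ?_⟩, fun p => hJB (some p)⟩
    have := hJB none
    simpa [B', u] using this.symm)
  let Z : Matrix n n 𝕜 := (t : 𝕜) • 1 - G none
  have hpos' : ∀ j, (Z - ∑ p, (w j p : 𝕜) • G (some p)).PosDef := fun j => by
    have := hpos j
    rwa [Fintype.sum_option, ← sub_sub, show (u j none : 𝕜) • G none = G none by simp [u]] at this
  -- Averaging `hpos'` over `j` removes the `w`-terms, since each coordinate of `w` sums to zero.
  have hZ : Z.PosDef := by
    have hsum : (∑ j : σ, (Z - ∑ p, (w j p : 𝕜) • G (some p))).PosDef :=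
      Matrix.posDef_sum Finset.univ_nonempty fun j _ => hpos' j
    have hz : ∑ j : σ, ∑ p, (w j p : 𝕜) • G (some p) = 0 := by
      rw [Finset.sum_comm]
      refine Finset.sum_eq_zero fun p _ => ?_
      rw [← Finset.sum_smul, ← RCLike.ofReal_sum, hw, RCLike.ofReal_zero, zero_smul]
    rw [Finset.sum_sub_distrib, hz, sub_zero, Finset.sum_const, Finset.card_univ] at hsum
    have hσ : (0 : ℝ) < (Fintype.card σ : ℝ)⁻¹ :=
      inv_pos.mpr (by exact_mod_cast Fintype.card_pos)
    have := hsum.smul (show (0 : 𝕜) < (((Fintype.card σ : ℝ)⁻¹ : ℝ) : 𝕜) by exact_mod_cast hσ)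
    rw [← Nat.cast_smul_eq_nsmul 𝕜, smul_smul] at this
    rwa [show ((((Fintype.card σ : ℝ)⁻¹ : ℝ) : 𝕜) * (Fintype.card σ : 𝕜)) = 1 by
      have : (Fintype.card σ : 𝕜) ≠ 0 := by exact_mod_cast Fintype.card_ne_zero
      rw [RCLike.ofReal_inv, RCLike.ofReal_natCast, inv_mul_cancel₀ this], one_smul] at this
  obtain ⟨C, hC, hZC⟩ := exists_isUnit_eq_conjTranspose_mul_self hZ
  -- The congruence by `C⁻¹` turns `Z` into `I`, so the separating inequalities say that `X` lies in
  -- the free spectrahedron.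
  let X : ι → Matrix n n 𝕜 := fun p => (C⁻¹).conjTranspose * G (some p) * C⁻¹
  have hXH : ∀ p, (X p).IsHermitian := fun p =>
    Matrix.isHermitian_conjTranspose_mul_mul _ (hG (some p))
  have hCC : (C⁻¹).conjTranspose * (C.conjTranspose * C) * C⁻¹ = 1 := by
    rw [← mul_assoc, ← Matrix.conjTranspose_mul, Matrix.mul_nonsing_inv _ hC,
      Matrix.conjTranspose_one, one_mul, Matrix.mul_nonsing_inv _ hC]
  have hCX : ∀ p, C.conjTranspose * X p * C = G (some p) := fun p => by
    simp only [X, mul_assoc, Matrix.nonsing_inv_mul _ hC, mul_one]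
    rw [← mul_assoc, ← Matrix.conjTranspose_mul, Matrix.nonsing_inv_mul _ hC,
      Matrix.conjTranspose_one, one_mul]
  have hX1 : ∀ j, (1 - ∑ p, (w j p : 𝕜) • X p).PosSemidef := fun j => by
    have := (hpos' j).posSemidef.conjTranspose_mul_mul_same C⁻¹
    rw [mul_sub, sub_mul, hZC, hCC, Finset.mul_sum, Finset.sum_mul] at this
    simpa only [Matrix.mul_smul, Matrix.smul_mul] using this
  have hfin := h X hXH hX1
  -- Evaluating at `C` read as a vector undoes the congruence: the pairing of `B` with `G` is at
  -- most `tr Z = t n - tr (G none)`, against `hlt`.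
  have hform := hfin.re_dotProduct_nonneg (fun q : n × n => C q.2 q.1)
  rw [Matrix.sub_mulVec, dotProduct_sub, Matrix.one_mulVec, Matrix.sum_mulVec, dotProduct_sum,
    map_sub, map_sum] at hform
  simp only [dotProduct_kronecker_mulVec, hCX] at hform
  have htrZ : star (fun q : n × n => C q.2 q.1) ⬝ᵥ (fun q : n × n => C q.2 q.1) = Z.trace := by
    rw [hZC]
    simp [dotProduct, Fintype.sum_prod_type, Matrix.trace, Matrix.mul_apply]
  rw [htrZ] at hform
  have hnone : ∑ a, ∑ b, B' none a b * G none a b = (G none).trace := by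
    simp [B', Matrix.one_apply, Matrix.trace]
  rw [Fintype.sum_option, hnone] at hlt
  have hZtr : RCLike.re Z.trace = t * Fintype.card n - RCLike.re (G none).trace := by
    simp only [Z, Matrix.trace_sub, Matrix.trace_smul, Matrix.trace_one, smul_eq_mul, map_sub,
      RCLike.re_ofReal_mul, RCLike.natCast_re]
  rw [hZtr] at hform
  change t * _ < _ + ∑ p, RCLike.re (∑ a, ∑ b, B p a b * G (some p) a b) at hlt
  linarith

end Duality

/-! ### Combinatorics of the jewel vectors and vertices -/

section JewelVectors

theorem sum_univ_fin_eq_sum_add_last {M : Type*} [AddCommMonoid M] {k : ℕ} (hk : 0 < k)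
    (f : Fin k → M) :
    ∑ l, f l = ∑ i : Fin (k - 1), f ⟨i, by omega⟩ + f ⟨k - 1, by omega⟩ := by
  obtain ⟨m, rfl⟩ : ∃ m, k = m + 1 := ⟨k - 1, by omega⟩
  rw [Fin.sum_univ_castSucc]
  rfl

theorem sum_jewelVec_outcome {k : ℕ} (i : Fin (k - 1)) : ∑ l, jewelVec k i l = 0 := by
  have hi := i.2
  have hk : (k : ℝ) ≠ 0 := by
    have : k ≠ 0 := by omega
    exact_mod_cast this
  have h : ∑ l : Fin k, (if l.val = i.val then (1 : ℝ) else 0) = 1 := by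
    rw [Finset.sum_eq_single (⟨i, by omega⟩ : Fin k)]
    · simp
    · intro l _ hl
      rw [if_neg fun h => hl (Fin.ext h)]
    · simp
  simp only [jewelVec, Finset.sum_add_distrib, ← Finset.mul_sum, h, Finset.sum_const,
    Finset.card_univ, Fintype.card_fin, nsmul_eq_mul]
  field_simp
  ring

theorem sum_jewelVec_index {k : ℕ} (hk : 0 < k) (l : Fin k) :
    ∑ i, jewelVec k i l = 2 / k - 2 * (if l.val = k - 1 then 1 else 0) := by
  have hk0 : (k : ℝ) ≠ 0 := by exact_mod_cast hk.ne'
  have h : ∑ i : Fin (k - 1), (if l.val = i.val then (1 : ℝ) else 0) =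
      1 - (if l.val = k - 1 then 1 else 0) := by
    split_ifs with hl
    · rw [sub_self]
      exact Finset.sum_eq_zero fun i _ => if_neg (by omega)
    · rw [Finset.sum_eq_single (⟨l, by omega⟩ : Fin (k - 1))]
      · simp
      · intro i _ hi
        rw [if_neg fun h => hi (Fin.ext h.symm)]
      · simp
  simp only [jewelVec, Finset.sum_add_distrib, ← Finset.mul_sum, h, Finset.sum_const,
    Finset.card_univ, Fintype.card_fin, nsmul_eq_mul, Nat.cast_sub hk, Nat.cast_one]
  field_simp
  ring

variable {g : ℕ}

/-- The row of the diagonal matrices `jewelMatrix 𝕜 k p` at the position `j`; these are the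
vertices of the polar dual of the first level of the matrix jewel. -/
noncomputable def jewelVertex (k : Fin g → ℕ) (j : (x : Fin g) → Fin (k x)) (p : JewelIndex k) :
    ℝ :=
  jewelVec (k p.1) p.2 (j p.1)

/-- The origin is the barycentre of the vertices. Both the duality argument and the boundedness of
the jewel rest on this; it reduces to the zero sum of each `jewelVec` by freezing all outcomes
except the one at `p.1`. -/
theorem sum_jewelVertex (k : Fin g → ℕ) (p : JewelIndex k) : ∑ j, jewelVertex k j p = 0 := by
  rw [← (Equiv.piSplitAt p.1 fun x => Fin (k x)).symm.sum_comp, Fintype.sum_prod_type,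
    Finset.sum_comm]
  refine Finset.sum_eq_zero fun e _ => ?_
  rw [← sum_jewelVec_outcome p.2]
  refine Finset.sum_congr rfl fun l _ => ?_
  simp [jewelVertex, Equiv.piSplitAt]

/-- The functional `y ↦ ∑ i, y_{i|x}` on `ℝ^N`, as a vector. -/
noncomputable def sumFunctional (k : Fin g → ℕ) (x : Fin g) (p : JewelIndex k) : ℝ :=
  if p.1 = x then 1 else 0

theorem sumFunctional_dotProduct (k : Fin g → ℕ) (x : Fin g) (y : JewelIndex k → ℝ) :
    sumFunctional k x ⬝ᵥ y = ∑ i, y ⟨x, i⟩ := by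
  simp only [dotProduct, sumFunctional, Fintype.sum_sigma]
  rw [Finset.sum_eq_single x]
  · simp
  · intro x' _ h
    simp [h]
  · simp

theorem sumFunctional_dotProduct_jewelVertex {k : Fin g → ℕ} (hk : ∀ x, 0 < k x) (x : Fin g)
    (j : (x : Fin g) → Fin (k x)) :
    sumFunctional k x ⬝ᵥ jewelVertex k j =
      2 / k x - 2 * (if (j x).val = k x - 1 then 1 else 0) := by
  rw [sumFunctional_dotProduct, ← sum_jewelVec_index (hk x)]
  rfl

end JewelVectors

/-! ### Levels of the jewel and inequalities on the polar dual -/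

section Levels

variable {𝕜 : Type*} [RCLike 𝕜]

/-- The matrix inequality is block diagonal, with one block for each `j`. -/
theorem mem_freeSpectrahedron_diagonal {ι σ : Type*} [Fintype ι] [Fintype σ] [DecidableEq σ]
    (w : σ → ι → ℝ) {n : ℕ} (X : ι → Matrix (Fin n) (Fin n) 𝕜) :
    X ∈ freeSpectrahedron (fun p => Matrix.diagonal fun j => (w j p : 𝕜)) n ↔
      (∀ p, (X p).IsHermitian) ∧ ∀ j, (1 - ∑ p, (w j p : 𝕜) • X p).PosSemidef := by
  refine and_congr_right fun hX => ⟨fun h j => ?_, fun h => ?_⟩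
  · have := h.submatrix fun a : Fin n => (j, a)
    convert this using 1
    ext a b
    simp [Matrix.sum_apply, Matrix.one_apply, RCLike.real_smul_eq_coe_mul]
  · have h1 : (1 - ∑ p, (Matrix.diagonal fun j => (w j p : 𝕜)) ⊗ₖ X p) =
        ∑ j, (Matrix.diagonal (Pi.single j (1 : 𝕜))) ⊗ₖ (1 - ∑ p, (w j p : 𝕜) • X p) := by
      ext ⟨j, a⟩ ⟨j', b⟩
      simp only [Matrix.sub_apply, Matrix.sum_apply, Matrix.kroneckerMap_apply, Matrix.smul_apply,
        smul_eq_mul]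
      rw [Finset.sum_eq_single j]
      · by_cases hj : j = j'
        · subst hj
          simp [Matrix.one_apply]
        · simp [hj, Matrix.one_apply]
      · intro l _ hl
        rw [Matrix.diagonal_apply]
        split_ifs <;> simp [hl.symm]
      · simp
    rw [h1]
    refine Matrix.posSemidef_sum _ fun j _ => ?_
    refine Matrix.PosSemidef.kronecker (Matrix.PosSemidef.diagonal ?_) (h j)
    exact Pi.single_nonneg.mpr zero_le_one

variable {g : ℕ} {k : Fin g → ℕ}

theorem mem_matrixJewel_iff {n : ℕ} {X : JewelIndex k → Matrix (Fin n) (Fin n) 𝕜} :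
    X ∈ matrixJewel 𝕜 k n ↔ (∀ p, (X p).IsHermitian) ∧
      ∀ j, (1 - ∑ p, (jewelVertex k j p : 𝕜) • X p).PosSemidef :=
  mem_freeSpectrahedron_diagonal (jewelVertex k) X

theorem smul_one_mem_matrixJewel {n : ℕ} {x : JewelIndex k → ℝ}
    (hx : ∀ j, x ⬝ᵥ jewelVertex k j ≤ 1) :
    (fun p => (x p : 𝕜) • (1 : Matrix (Fin n) (Fin n) 𝕜)) ∈ matrixJewel 𝕜 k n := by
  refine mem_matrixJewel_iff.mpr ⟨fun p => ?_, fun j => ?_⟩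
  · simp [Matrix.IsHermitian, Matrix.conjTranspose_smul]
  · have : (1 - ∑ p, (jewelVertex k j p : 𝕜) • (x p : 𝕜) • (1 : Matrix (Fin n) (Fin n) 𝕜)) =
        ((1 - x ⬝ᵥ jewelVertex k j : ℝ) : 𝕜) • 1 := by
      simp only [smul_smul, ← Finset.sum_smul, ← RCLike.ofReal_mul, ← RCLike.ofReal_sum]
      rw [RCLike.ofReal_sub, sub_smul, RCLike.ofReal_one, one_smul, dotProduct]
      simp only [mul_comm]
    rw [this]
    exact Matrix.PosSemidef.one.smul (by exact_mod_cast sub_nonneg.mpr (hx j))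

theorem mem_levelOne_matrixJewel_iff {x : JewelIndex k → ℝ} :
    x ∈ levelOne (matrixJewel 𝕜 k) ↔ ∀ j, x ⬝ᵥ jewelVertex k j ≤ 1 := by
  have hof : ∀ r : ℝ, (Matrix.of fun _ _ : Fin 1 => (r : 𝕜)) = (r : 𝕜) • 1 := fun r => by
    ext a b
    simp [Subsingleton.elim a b]
  constructor
  · intro h j
    have h1 := (mem_matrixJewel_iff.mp h).2 j
    have h2 := h1.diag_nonneg (i := 0)
    simp only [Matrix.sub_apply, Matrix.sum_apply, Matrix.smul_apply, Matrix.one_apply_eq,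
      Matrix.of_apply, smul_eq_mul, ← RCLike.ofReal_mul, ← RCLike.ofReal_sum] at h2
    rw [sub_nonneg] at h2
    have h3 : ∑ p, jewelVertex k j p * x p ≤ 1 := by exact_mod_cast h2
    rwa [dotProduct_comm]
  · intro h
    change (fun p => Matrix.of fun _ _ => (x p : 𝕜)) ∈ matrixJewel 𝕜 k 1
    simp only [hof]
    exact smul_one_mem_matrixJewel h

theorem jewelVertex_mem_polarDual (j : (x : Fin g) → Fin (k x)) :
    jewelVertex k j ∈ polarDual (levelOne (matrixJewel 𝕜 k)) :=
  fun _ hx => mem_levelOne_matrixJewel_iff.mp hx j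

/-- As an inequality on the polar dual, this point says `y_{i|x} ≥ -2/k_x`, which will be positivity
of the effect `E_{i|x}`. -/
theorem single_smul_mem_levelOne (p : JewelIndex k) :
    Pi.single p (-((k p.1 : ℝ) / 2)) ∈ levelOne (matrixJewel 𝕜 k) := by
  refine mem_levelOne_matrixJewel_iff.mpr fun j => ?_
  have hi := p.2.2
  have hk : (0 : ℝ) < k p.1 := by
    have : 0 < k p.1 := by omega
    exact_mod_cast this
  rw [single_dotProduct, jewelVertex, jewelVec]
  have : -((k p.1 : ℝ) / 2) * (-(2 / (k p.1 : ℝ)) + 2 * if (j p.1).val = p.2.val then 1 else 0) =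
      1 - k p.1 * (if (j p.1).val = p.2.val then 1 else 0) := by
    field_simp
    ring
  rw [this]
  split_ifs <;> linarith

theorem smul_sumFunctional_dotProduct_jewelVertex (hk : ∀ x, 0 < k x) (x : Fin g)
    (j : (x : Fin g) → Fin (k x)) :
    (((k x : ℝ) / 2) • sumFunctional k x) ⬝ᵥ jewelVertex k j =
      1 - k x * (if (j x).val = k x - 1 then 1 else 0) := by
  have hk0 : (k x : ℝ) ≠ 0 := by exact_mod_cast (hk x).ne'
  rw [smul_dotProduct, sumFunctional_dotProduct_jewelVertex hk, smul_eq_mul]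
  field_simp

/-- On the polar dual this gives `∑ i, y_{i|x} ≤ 2/k_x`, which will be positivity of the last
effect. -/
theorem smul_sumFunctional_dotProduct_jewelVertex_le (hk : ∀ x, 0 < k x) (x : Fin g)
    (j : (x : Fin g) → Fin (k x)) :
    (((k x : ℝ) / 2) • sumFunctional k x) ⬝ᵥ jewelVertex k j ≤ 1 := by
  rw [smul_sumFunctional_dotProduct_jewelVertex hk]
  have : (0 : ℝ) ≤ k x := Nat.cast_nonneg _
  split_ifs <;> linarith

end Levels

/-! ### Measurements as points of the dual free polytope -/

section Measurements

variable {𝕜 : Type*} [RCLike 𝕜] {g d : ℕ} {k : Fin g → ℕ}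

/-- The tuple `2 E_{i|x} - (2 / k_x) I` corresponding to a tuple of measurements. -/
noncomputable def jewelTuple (E : MeasTuple 𝕜 d k) (p : JewelIndex k) :
    Matrix (Fin d) (Fin d) 𝕜 :=
  (2 : 𝕜) • E p.1 ⟨p.2, by have := p.2.2; omega⟩ - ((2 / (k p.1 : ℝ) : ℝ) : 𝕜) • 1

theorem jewelTuple_eq_sum {E : MeasTuple 𝕜 d k} (hE : ∀ x, ∑ i, E x i = 1) (p : JewelIndex k) :
    jewelTuple E p = ∑ l, (jewelVec (k p.1) p.2 l : 𝕜) • E p.1 l := by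
  have hi := p.2.2
  have h : ∑ l, (if l.val = p.2.val then (1 : 𝕜) else 0) • E p.1 l = E p.1 ⟨p.2, by omega⟩ := by
    rw [Finset.sum_eq_single (⟨p.2, by omega⟩ : Fin (k p.1))]
    · simp
    · intro l _ hl
      rw [if_neg fun h => hl (Fin.ext h), zero_smul]
    · simp
  have h2 : ∀ l : Fin (k p.1), (jewelVec (k p.1) p.2 l : 𝕜) • E p.1 l =
      (2 : 𝕜) • (if l.val = p.2.val then (1 : 𝕜) else 0) • E p.1 l -
        ((2 / (k p.1 : ℝ) : ℝ) : 𝕜) • E p.1 l := fun l => by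
    rw [smul_smul, ← sub_smul]
    congr 1
    rw [jewelVec]
    split_ifs <;> push_cast <;> ring
  rw [Finset.sum_congr rfl fun l _ => h2 l, Finset.sum_sub_distrib, ← Finset.smul_sum,
    ← Finset.smul_sum, h, hE, jewelTuple]

theorem jewelTuple_injective {E F : MeasTuple 𝕜 d k} (hk : ∀ x, 0 < k x)
    (hE : ∀ x, ∑ i, E x i = 1) (hF : ∀ x, ∑ i, F x i = 1) (h : jewelTuple E = jewelTuple F) :
    E = F := by
  have h1 : ∀ (x : Fin g) (i : Fin (k x - 1)), E x ⟨i, by omega⟩ = F x ⟨i, by omega⟩ :=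
    fun x i => by
      have := congrFun h ⟨x, i⟩
      simp only [jewelTuple, sub_left_inj] at this
      exact smul_right_injective _ (two_ne_zero (α := 𝕜)) this
  have h2 : ∀ x, E x ⟨k x - 1, by have := hk x; omega⟩ = F x ⟨k x - 1, by have := hk x; omega⟩ :=
    fun x => by
      have hEF := (hE x).trans (hF x).symm
      rw [sum_univ_fin_eq_sum_add_last (hk x), sum_univ_fin_eq_sum_add_last (hk x),
        Finset.sum_congr rfl fun i _ => h1 x i] at hEF
      exact add_left_cancel hEF
  funext x i
  by_cases hi : i.val < k x - 1
  · exact h1 x ⟨i, hi⟩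
  · have : i = ⟨k x - 1, by have := hk x; omega⟩ := Fin.ext (by have := i.2; simp only; omega)
    rw [this]
    exact h2 x

theorem sum_noisy {E : MeasTuple 𝕜 d k} (hk : ∀ x, 0 < k x) (hE : ∀ x, ∑ i, E x i = 1) (s : ℝ)
    (x : Fin g) : ∑ i, noisy s E x i = 1 := by
  have hk0 : (k x : ℝ) ≠ 0 := by exact_mod_cast (hk x).ne'
  simp only [noisy, Finset.sum_add_distrib, ← Finset.smul_sum, hE, Finset.sum_const,
    Finset.card_univ, Fintype.card_fin]
  rw [← Nat.cast_smul_eq_nsmul 𝕜, smul_smul, ← add_smul,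
    show ((k x : ℕ) : 𝕜) = ((k x : ℝ) : 𝕜) from (RCLike.ofReal_natCast _).symm, ← RCLike.ofReal_mul, div_mul_cancel₀ _ hk0, ← RCLike.ofReal_add, add_sub_cancel,
    RCLike.ofReal_one, one_smul]

/-- Mixing with `I / k_x` is linear scaling because the trivial measurement corresponds to the zero
tuple. -/
theorem jewelTuple_noisy (E : MeasTuple 𝕜 d k) (s : ℝ) (p : JewelIndex k) :
    jewelTuple (noisy s E) p = (s : 𝕜) • jewelTuple E p := by
  simp only [jewelTuple, noisy, smul_add, smul_sub, smul_smul]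
  rw [mul_comm (2 : 𝕜) (s : 𝕜), add_sub_assoc, ← sub_smul, sub_eq_add_neg (_ • E _ _), ← neg_smul]
  congr 2
  push_cast
  ring

/-- The marginals of a joint measurement. -/
def marginals (J : ((x : Fin g) → Fin (k x)) → Matrix (Fin d) (Fin d) 𝕜) : MeasTuple 𝕜 d k :=
  fun x i => ∑ j with j x = i, J j

theorem sum_marginals (J : ((x : Fin g) → Fin (k x)) → Matrix (Fin d) (Fin d) 𝕜) (x : Fin g) :
    ∑ i, marginals J x i = ∑ j, J j :=
  Finset.sum_fiberwise Finset.univ (fun j : (x : Fin g) → Fin (k x) => j x) J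

theorem jewelTuple_marginals {J : ((x : Fin g) → Fin (k x)) → Matrix (Fin d) (Fin d) 𝕜}
    (hJ : ∑ j, J j = 1) (p : JewelIndex k) :
    jewelTuple (marginals J) p = ∑ j, (jewelVertex k j p : 𝕜) • J j := by
  rw [jewelTuple_eq_sum fun x => (sum_marginals J x).trans hJ,
    ← Finset.sum_fiberwise Finset.univ (fun j : (x : Fin g) → Fin (k x) => j p.1)]
  refine Finset.sum_congr rfl fun l _ => ?_
  rw [marginals, Finset.smul_sum]
  refine Finset.sum_congr rfl fun j hj => ?_
  rw [jewelVertex, (Finset.mem_filter.mp hj).2]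

theorem isCompatible_noisy_iff {E : MeasTuple 𝕜 d k} (hk : ∀ x, 0 < k x)
    (hE : ∀ x, ∑ i, E x i = 1) (s : ℝ) :
    IsCompatible (noisy s E) ↔
      ∃ J : ((x : Fin g) → Fin (k x)) → Matrix (Fin d) (Fin d) 𝕜, IsPOVM J ∧
        ∀ p, (s : 𝕜) • jewelTuple E p = ∑ j, (jewelVertex k j p : 𝕜) • J j := by
  refine exists_congr fun J => and_congr_right fun hJ => ⟨fun h p => ?_, fun h => ?_⟩
  · rw [← jewelTuple_marginals hJ.2, ← jewelTuple_noisy]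
    exact congrArg (fun F => jewelTuple F p) (funext fun x => funext fun i => h x i)
  · have := jewelTuple_injective hk (sum_noisy hk hE s)
      (fun x => (sum_marginals J x).trans hJ.2) (funext fun p => by
        rw [jewelTuple_marginals hJ.2, jewelTuple_noisy, h])
    exact fun x i => congrFun (congrFun this x) i

theorem jewelTuple_isHermitian {E : MeasTuple 𝕜 d k} (hE : ∀ x, IsPOVM (E x))
    (p : JewelIndex k) : (jewelTuple E p).IsHermitian := by
  refine Matrix.IsHermitian.sub ?_ ?_
  · have := ((hE p.1).1 ⟨p.2, by have := p.2.2; omega⟩).1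
    rw [Matrix.IsHermitian, Matrix.conjTranspose_smul, this.eq]
    simp
  · simp [Matrix.IsHermitian, Matrix.conjTranspose_smul]

theorem jewelTuple_mem_dualFreePolytope {E : MeasTuple 𝕜 d k} (hk : ∀ x, 0 < k x)
    (hE : ∀ x, IsPOVM (E x)) : jewelTuple E ∈ dualFreePolytope (matrixJewel 𝕜 k) d := by
  refine ⟨jewelTuple_isHermitian hE, fun a a₀ ha => ?_⟩
  let f : (x : Fin g) → Fin (k x) → ℝ := fun x l => ∑ i, a ⟨x, i⟩ * jewelVec (k x) i l
  have hmax : ∀ x, ∃ l, ∀ l', f x l' ≤ f x l := fun x => by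
    have : Nonempty (Fin (k x)) := ⟨⟨0, hk x⟩⟩
    exact Finite.exists_max (f x)
  -- On vertices the functional `a` splits into a sum over `x` of terms in `j x` alone, so it is
  -- maximised for each `x` separately, and the optimal vertex bounds `a₀` from below.
  choose j hj using hmax
  have hle : ∑ x, f x (j x) ≤ a₀ := by
    have := ha _ (jewelVertex_mem_polarDual j)
    rwa [dotProduct, Fintype.sum_sigma] at this
  have hsum : ∑ p, (a p : 𝕜) • jewelTuple E p = ∑ x, ∑ l, (f x l : 𝕜) • E x l := by
    rw [Fintype.sum_sigma]
    refine Finset.sum_congr rfl fun x _ => ?_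
    have hT : ∀ i, jewelTuple E ⟨x, i⟩ = ∑ l : Fin (k x), (jewelVec (k x) i l : 𝕜) • E x l :=
      fun i => jewelTuple_eq_sum (fun x => (hE x).2) ⟨x, i⟩
    simp only [hT, Finset.smul_sum, smul_smul]
    rw [Finset.sum_comm]
    refine Finset.sum_congr rfl fun l _ => ?_
    rw [← Finset.sum_smul]
    simp only [f, RCLike.ofReal_sum, RCLike.ofReal_mul]
  have hsplit : (a₀ : 𝕜) • (1 : Matrix (Fin d) (Fin d) 𝕜) - ∑ x, ∑ l, (f x l : 𝕜) • E x l =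
      ((a₀ - ∑ x, f x (j x) : ℝ) : 𝕜) • 1 +
        ∑ x, ∑ l, ((f x (j x) - f x l : ℝ) : 𝕜) • E x l := by
    simp only [RCLike.ofReal_sub, sub_smul, Finset.sum_sub_distrib, ← Finset.smul_sum,
      RCLike.ofReal_sum, fun x => (hE x).2, Finset.sum_smul]
    abel
  rw [hsum, hsplit]
  refine (Matrix.PosSemidef.one.smul ?_).add (Matrix.posSemidef_sum _ fun x _ =>
    Matrix.posSemidef_sum _ fun l _ => ((hE x).1 l).smul ?_)
  · exact_mod_cast sub_nonneg.mpr hle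
  · exact_mod_cast sub_nonneg.mpr (hj x l)

theorem exists_eq_jewelTuple_of_mem_dualFreePolytope (hk : ∀ x, 0 < k x)
    {A : JewelIndex k → Matrix (Fin d) (Fin d) 𝕜}
    (hA : A ∈ dualFreePolytope (matrixJewel 𝕜 k) d) :
    ∃ E : MeasTuple 𝕜 d k, (∀ x, IsPOVM (E x)) ∧ A = jewelTuple E := by
  have hlow : ∀ p, (A p + ((2 / (k p.1 : ℝ) : ℝ) : 𝕜) • 1).PosSemidef := fun p => by
    have h := hA.2 (Pi.single p (-1)) (2 / k p.1) fun y hy => by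
      have h1 := hy _ (single_smul_mem_levelOne p)
      have hk0 : (0 : ℝ) < k p.1 := by exact_mod_cast hk p.1
      rw [single_dotProduct] at h1 ⊢
      rw [le_div_iff₀ hk0]
      linarith
    rw [Finset.sum_eq_single p] at h
    · simpa [add_comm] using h
    · intro q _ hq
      simp [Pi.single_eq_of_ne hq]
    · simp
  have hup : ∀ x, (((2 / (k x : ℝ) : ℝ) : 𝕜) • 1 - ∑ i, A ⟨x, i⟩).PosSemidef := fun x => by
    have h := hA.2 (sumFunctional k x) (2 / k x) fun y hy => by
      have h1 := hy _ (mem_levelOne_matrixJewel_iff.mpr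
        (smul_sumFunctional_dotProduct_jewelVertex_le hk x))
      have hk0 : (0 : ℝ) < k x := by exact_mod_cast hk x
      rw [smul_dotProduct, smul_eq_mul] at h1
      rw [le_div_iff₀ hk0]
      linarith
    rw [Fintype.sum_sigma, Finset.sum_eq_single x] at h
    · simpa [sumFunctional] using h
    · intro x' _ hx
      simp [sumFunctional, hx]
    · simp
  have hhalf : (0 : 𝕜) ≤ ((1 / 2 : ℝ) : 𝕜) := by
    exact_mod_cast (by norm_num : (0 : ℝ) ≤ 1 / 2)
  -- Inverts the affine map; the last outcome receives what normalisation leaves over.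
  refine ⟨fun x l => if h : l.val < k x - 1 then
      ((1 / 2 : ℝ) : 𝕜) • (A ⟨x, ⟨l, h⟩⟩ + ((2 / (k x : ℝ) : ℝ) : 𝕜) • 1)
    else ((1 / 2 : ℝ) : 𝕜) • (((2 / (k x : ℝ) : ℝ) : 𝕜) • 1 - ∑ i, A ⟨x, i⟩),
    fun x => ⟨fun l => ?_, ?_⟩, funext fun p => ?_⟩
  · dsimp only
    split_ifs with h
    · exact (hlow ⟨x, ⟨l, h⟩⟩).smul hhalf
    · exact (hup x).smul hhalf
  · have hk0 : (k x : ℝ) ≠ 0 := by exact_mod_cast (hk x).ne'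
    rw [sum_univ_fin_eq_sum_add_last (hk x)]
    simp only [Fin.is_lt, dite_true, lt_irrefl, dite_false, Fin.eta, ← Finset.smul_sum,
      Finset.sum_add_distrib, Finset.sum_const, Finset.card_univ, Fintype.card_fin]
    rw [← smul_add, ← Nat.cast_smul_eq_nsmul 𝕜, 
      show ∀ a b c : Matrix (Fin d) (Fin d) 𝕜, a + b + (c - a) = b + c from fun a b c => by abel,
      smul_smul, ← add_smul, smul_smul,
      show ((k x - 1 : ℕ) : 𝕜) = (((k x - 1 : ℕ) : ℝ) : 𝕜) from (RCLike.ofReal_natCast _).symm,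
      ← RCLike.ofReal_mul, ← RCLike.ofReal_add,
      ← RCLike.ofReal_mul, Nat.cast_sub (hk x)]
    rw [show (1 / 2 * (2 / (k x : ℝ) * ((k x : ℝ) - (Nat.succ 0 : ℕ)) + 2 / k x)) = 1 by
      field_simp; push_cast; ring, RCLike.ofReal_one, one_smul]
  · simp only [jewelTuple, Fin.is_lt, dite_true, Fin.eta, smul_smul]
    rw [show (2 : 𝕜) * ((1 / 2 : ℝ) : 𝕜) = 1 by push_cast; norm_num, one_smul, add_sub_cancel_right]

end Measurements

/-! ### Compactness of the jewel, its dual and the admissible noise parameters -/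

section Compactness

variable {𝕜 : Type*} [RCLike 𝕜] {g d : ℕ} {k : Fin g → ℕ}

theorem isClosed_setOf_isHermitian {ι n : Type*} :
    IsClosed {X : ι → Matrix n n 𝕜 | ∀ p, (X p).IsHermitian} := by
  simp only [Set.ofPred_forall]
  refine isClosed_iInter fun p => ?_
  have hp : Continuous fun X : ι → Matrix n n 𝕜 => X p := continuous_apply p
  exact isClosed_eq hp.matrix_conjTranspose hp

theorem continuous_sum_smul {ι n : Type*} [Fintype ι] (a : ι → 𝕜) :
    Continuous fun X : ι → Matrix n n 𝕜 => ∑ p, a p • X p := by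
  refine continuous_finsetSum _ fun p _ => ?_
  have hp : Continuous fun X : ι → Matrix n n 𝕜 => X p := continuous_apply p
  exact hp.const_smul (a p)

/-- Replacing outcome `i` of measurement `x` by the last outcome changes a single coordinate, so one
variable `X_{i|x}` can be isolated as a difference of two jewel constraints. -/
theorem jewelVertex_sub_update (j : (x : Fin g) → Fin (k x)) (p : JewelIndex k)
    (hj : (j p.1).val = p.2.val) (q : JewelIndex k) :
    jewelVertex k j q - jewelVertex k
      (Function.update j p.1 ⟨k p.1 - 1, by have := p.2.2; omega⟩) q = if q = p then 2 else 0 := by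
  obtain ⟨x, i⟩ := p
  obtain ⟨y, l⟩ := q
  by_cases hxy : y = x
  · subst hxy
    have h1 : k y - 1 ≠ l.val := by have := l.2; omega
    simp only at hj
    by_cases hil : l = i
    · subst hil
      simp [jewelVertex, jewelVec, hj, h1]
    · have h2 : i.val ≠ l.val := fun h => hil (Fin.ext h.symm)
      simp [jewelVertex, jewelVec, hj, h1, h2, hil]
  · have : (⟨y, l⟩ : JewelIndex k) ≠ ⟨x, i⟩ := fun h => hxy (congrArg Sigma.fst h)
    simp [jewelVertex, Function.update_of_ne hxy, this]

/-- The slacks `Q j` are positive semidefinite and sum to `N I`, as the vertices sum to zero; hence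
`0 ≼ Q j ≼ N I`. Each `X p` is half a difference of two slacks, so it lies between `-(N/2) I` and
`(N/2) I`. Here `N` counts the joint outcomes. -/
theorem isCompact_matrixJewel (hk : ∀ x, 0 < k x) (n : ℕ) : IsCompact (matrixJewel 𝕜 k n) := by
  let N : ℝ := Fintype.card ((x : Fin g) → Fin (k x))
  have hN : 0 ≤ N := Nat.cast_nonneg _
  refine isCompact_of_isClosed_of_norm_apply_le ?_ (2 * (N / 2) * Fintype.card (Fin n) + N / 2)
    fun X hX p => ?_
  · have : matrixJewel 𝕜 k n = {X | ∀ p, (X p).IsHermitian} ∩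
        ⋂ j, {X | (1 - ∑ p, (jewelVertex k j p : 𝕜) • X p).PosSemidef} := by
      ext X
      simp [mem_matrixJewel_iff]
    rw [this]
    refine isClosed_setOf_isHermitian.inter (isClosed_iInter fun j => ?_)
    exact isClosed_posSemidef.preimage (continuous_const.sub (continuous_sum_smul _))
  · obtain ⟨-, hX⟩ := mem_matrixJewel_iff.mp hX
    let Q : ((x : Fin g) → Fin (k x)) → Matrix (Fin n) (Fin n) 𝕜 :=
      fun j => 1 - ∑ p, (jewelVertex k j p : 𝕜) • X p
    have hQsum : ∑ j, Q j = (N : 𝕜) • 1 := by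
      have hz : ∑ j : (x : Fin g) → Fin (k x), ∑ p, (jewelVertex k j p : 𝕜) • X p = 0 := by
        rw [Finset.sum_comm]
        refine Finset.sum_eq_zero fun p _ => ?_
        rw [← Finset.sum_smul, ← RCLike.ofReal_sum, sum_jewelVertex, RCLike.ofReal_zero, zero_smul]
      simp only [Q]
      rw [Finset.sum_sub_distrib, hz, sub_zero, Finset.sum_const, Finset.card_univ,
        ← Nat.cast_smul_eq_nsmul 𝕜]
      simp only [N, RCLike.ofReal_natCast]
    have hQle : ∀ j, ((N : 𝕜) • 1 - Q j).PosSemidef := fun j => by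
      rw [← hQsum, ← Finset.add_sum_erase _ _ (Finset.mem_univ j), add_sub_cancel_left]
      exact Matrix.posSemidef_sum _ fun j' _ => hX j'
    let j : (x : Fin g) → Fin (k x) := Function.update (fun x => ⟨0, hk x⟩) p.1
      ⟨p.2, by have := p.2.2; omega⟩
    have hj : (j p.1).val = p.2.val := by simp [j]
    let j' : (x : Fin g) → Fin (k x) := Function.update j p.1
      ⟨k p.1 - 1, by have := p.2.2; omega⟩
    have hdiff : Q j' - Q j = (2 : 𝕜) • X p := by
      simp only [Q, sub_sub_sub_cancel_left, ← Finset.sum_sub_distrib, ← sub_smul,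
        ← RCLike.ofReal_sub]
      rw [Finset.sum_eq_single p]
      · rw [jewelVertex_sub_update j p hj, if_pos rfl, RCLike.ofReal_ofNat]
      · intro q _ hq
        rw [jewelVertex_sub_update j p hj, if_neg hq, RCLike.ofReal_zero, zero_smul]
      · simp
    have hXp : X p = ((1 / 2 : ℝ) : 𝕜) • (Q j' - Q j) := by
      rw [hdiff, smul_smul, show ((1 / 2 : ℝ) : 𝕜) * 2 = 1 by push_cast; norm_num, one_smul]
    have hNsmul : ((N / 2 : ℝ) : 𝕜) • (1 : Matrix (Fin n) (Fin n) 𝕜) =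
        ((1 / 2 : ℝ) : 𝕜) • (N : 𝕜) • 1 := by
      rw [smul_smul, ← RCLike.ofReal_mul]
      congr 2
      ring
    have hhalf : (0 : 𝕜) ≤ ((1 / 2 : ℝ) : 𝕜) := by
      exact_mod_cast (by norm_num : (0 : ℝ) ≤ 1 / 2)
    refine norm_apply_le_of_le_of_le (by positivity) ?_ ?_
    · rw [hNsmul, hXp, ← smul_sub, ← sub_add]
      exact ((hQle j').add (hX j)).smul hhalf
    · rw [hNsmul, hXp, ← smul_add, add_comm, sub_add_eq_add_sub, add_sub_assoc]
      exact ((hX j').add (hQle j)).smul hhalf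

theorem posSemidef_one_sub_of_isPOVM {σ n : Type*} [Fintype σ] [Fintype n] [DecidableEq n]
    {E : σ → Matrix n n 𝕜} (hE : IsPOVM E) (i : σ) : (1 - E i).PosSemidef := by
  classical
  rw [← hE.2, ← Finset.add_sum_erase _ _ (Finset.mem_univ i), add_sub_cancel_left]
  exact Matrix.posSemidef_sum _ fun j _ => hE.1 j

theorem isCompact_dualFreePolytope_matrixJewel (hk : ∀ x, 0 < k x) :
    IsCompact (dualFreePolytope (matrixJewel 𝕜 k) d) := by
  refine isCompact_of_isClosed_of_norm_apply_le ?_ (2 * 2 * Fintype.card (Fin d) + 2)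
    fun A hA p => ?_
  · have : dualFreePolytope (matrixJewel 𝕜 k) d = {X | ∀ p, (X p).IsHermitian} ∩
        ⋂ (a : JewelIndex k → ℝ) (a₀ : ℝ)
          (_ : ∀ y ∈ polarDual (levelOne (matrixJewel 𝕜 k)), a ⬝ᵥ y ≤ a₀),
          {X | ((a₀ : 𝕜) • 1 - ∑ p, (a p : 𝕜) • X p).PosSemidef} := by
      ext X
      simp [dualFreePolytope, maxMatrixConvexSet]
    rw [this]
    refine isClosed_setOf_isHermitian.inter (isClosed_iInter fun a => isClosed_iInter fun a₀ =>
      isClosed_iInter fun _ => ?_)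
    exact isClosed_posSemidef.preimage (continuous_const.sub (continuous_sum_smul _))
  · obtain ⟨E, hE, rfl⟩ := exists_eq_jewelTuple_of_mem_dualFreePolytope hk hA
    have hk1 : (1 : ℝ) ≤ k p.1 := by exact_mod_cast hk p.1
    have hk2 : 2 / (k p.1 : ℝ) ≤ 2 := div_le_self (by norm_num) hk1
    have hk3 : 0 ≤ 2 / (k p.1 : ℝ) := by positivity
    have hi : p.2.val < k p.1 := by have := p.2.2; omega
    have h2 : (0 : 𝕜) ≤ 2 := zero_le_two
    refine norm_apply_le_of_le_of_le (c := 2) zero_le_two ?_ ?_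
    · have : ((2 : ℝ) : 𝕜) • 1 - jewelTuple E p =
          (2 : 𝕜) • (1 - E p.1 ⟨p.2, hi⟩) + ((2 / (k p.1 : ℝ) : ℝ) : 𝕜) • 1 := by
        rw [jewelTuple, smul_sub, RCLike.ofReal_ofNat]
        abel
      rw [this]
      exact ((posSemidef_one_sub_of_isPOVM (hE p.1) _).smul h2).add
        (Matrix.PosSemidef.one.smul (by exact_mod_cast hk3))
    · have : ((2 : ℝ) : 𝕜) • 1 + jewelTuple E p =
          (2 : 𝕜) • E p.1 ⟨p.2, hi⟩ + ((2 - 2 / (k p.1 : ℝ) : ℝ) : 𝕜) • 1 := by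
        rw [jewelTuple, RCLike.ofReal_sub, sub_smul]
        abel
      rw [this]
      exact (((hE p.1).1 _).smul h2).add
        (Matrix.PosSemidef.one.smul (by exact_mod_cast sub_nonneg.mpr hk2))

theorem isCompact_setOf_isPOVM {σ n : Type*} [Fintype σ] [Fintype n] [DecidableEq n] :
    IsCompact {J : σ → Matrix n n 𝕜 | IsPOVM J} := by
  have hclosed : IsClosed {J : σ → Matrix n n 𝕜 | ∑ j, J j = 1} := by
    refine isClosed_eq ?_ continuous_const
    simpa using continuous_sum_smul (𝕜 := 𝕜) (n := n) (fun _ : σ => 1)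
  have : {J : σ → Matrix n n 𝕜 | IsPOVM J} = {J : σ → Matrix n n 𝕜 |
      (∀ j, (J j).PosSemidef) ∧ ∑ j, RCLike.re (J j).trace = Fintype.card n} ∩
      {J | ∑ j, J j = 1} := by
    ext J
    refine ⟨fun h => ⟨⟨h.1, ?_⟩, h.2⟩, fun h => ⟨h.1.1, h.2⟩⟩
    rw [← map_sum, ← Matrix.trace_sum, h.2, Matrix.trace_one, RCLike.natCast_re]
  rw [this]
  exact (isCompact_posSemidef_trace_eq _).inter_right hclosed

/-- Compatible tuples are the continuous image, under `marginals`, of the compact set of joint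
measurements. -/
theorem isClosed_setOf_isCompatible : IsClosed {E : MeasTuple 𝕜 d k | IsCompatible E} := by
  have : {E : MeasTuple 𝕜 d k | IsCompatible E} = marginals '' {J | IsPOVM J} := by
    ext E
    refine exists_congr fun J => and_congr_right fun _ => ⟨fun h => ?_, fun h x i => ?_⟩
    · exact (funext fun x => funext fun i => h x i).symm
    · exact (congrFun (congrFun h x) i).symm
  rw [this]
  refine (isCompact_setOf_isPOVM.image ?_).isClosed
  refine continuous_pi fun x => continuous_pi fun i => continuous_finsetSum _ fun j _ => ?_
  exact continuous_apply j

theorem isCompact_compatParams (E : MeasTuple 𝕜 d k) : IsCompact (compatParams E) := by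
  refine isCompact_Icc.inter_right (isClosed_setOf_isCompatible.preimage ?_)
  refine continuous_pi fun x => continuous_pi fun i => ?_
  have h1 : Continuous fun s : ℝ => (s : 𝕜) := RCLike.continuous_ofReal
  have h2 : Continuous fun s : ℝ => (((1 - s) / (k x : ℝ) : ℝ) : 𝕜) :=
    RCLike.continuous_ofReal.comp (by fun_prop)
  exact (h1.smul (continuous_const (y := E x i))).add
    (h2.smul (continuous_const (y := (1 : Matrix (Fin d) (Fin d) 𝕜))))

end Compactness

/-! ### The pairing and the compatibility degree -/

section Main

variable {𝕜 : Type*} [RCLike 𝕜] {g d : ℕ} {k : Fin g → ℕ}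

theorem isHermitian_sum_kronecker {ι n : Type*} [Fintype ι] {A X : ι → Matrix n n 𝕜}
    (hA : ∀ p, (A p).IsHermitian) (hX : ∀ p, (X p).IsHermitian) :
    (∑ p, A p ⊗ₖ X p).IsHermitian := by
  rw [Matrix.IsHermitian, Matrix.conjTranspose_sum]
  exact Finset.sum_congr rfl fun p _ => by
    rw [Matrix.conjTranspose_kronecker, (hA p).eq, (hX p).eq]

/-- The pairing of tuples of matrices, evaluated in the vector state `v`. -/
noncomputable def kroneckerForm {ι n : Type*} [Fintype ι] [Fintype n]
    (A X : ι → Matrix n n 𝕜) (v : n × n → 𝕜) : ℝ :=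
  RCLike.re (star v ⬝ᵥ (∑ p, A p ⊗ₖ X p).mulVec v)

theorem continuous_kroneckerForm {ι n : Type*} [Fintype ι] [Fintype n] :
    Continuous fun q : (ι → Matrix n n 𝕜) × (ι → Matrix n n 𝕜) × (n × n → 𝕜) =>
      kroneckerForm q.1 q.2.1 q.2.2 := by
  simp only [kroneckerForm, dotProduct, Matrix.mulVec, Matrix.sum_apply,
    Matrix.kroneckerMap_apply, Pi.star_apply]
  refine RCLike.continuous_re.comp (continuous_finsetSum _ fun a _ => Continuous.mul (by fun_prop)
    (continuous_finsetSum _ fun b _ => Continuous.mul (continuous_finsetSum _ fun p _ => ?_)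
      (by fun_prop)))
  have h1 : Continuous fun q : (ι → Matrix n n 𝕜) × (ι → Matrix n n 𝕜) × (n × n → 𝕜) =>
    q.1 p := (continuous_apply p).comp continuous_fst
  have h2 : Continuous fun q : (ι → Matrix n n 𝕜) × (ι → Matrix n n 𝕜) × (n × n → 𝕜) =>
    q.2.1 p := (continuous_apply p).comp (continuous_fst.comp continuous_snd)
  exact (h1.matrix_elem _ _).mul (h2.matrix_elem _ _)

/-- If the noisy measurements with parameter `s` are compatible, then `s` times the pairing with
any element of the matrix jewel is at most `1`. -/
theorem mul_kroneckerForm_le_one_of_isCompatible {E : MeasTuple 𝕜 d k} (hk : ∀ x, 0 < k x)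
    (hE : ∀ x, IsPOVM (E x)) {s : ℝ} (hs : IsCompatible (noisy s E))
    {X : JewelIndex k → Matrix (Fin d) (Fin d) 𝕜} (hX : X ∈ matrixJewel 𝕜 k d)
    {v : Fin d × Fin d → 𝕜} (hv : star v ⬝ᵥ v = 1) :
    s * kroneckerForm (jewelTuple E) X v ≤ 1 := by
  obtain ⟨J, hJ, hJE⟩ := (isCompatible_noisy_iff hk (fun x => (hE x).2) s).mp hs
  obtain ⟨-, hX⟩ := mem_matrixJewel_iff.mp hX
  -- Inserting the joint measurement writes the difference as a sum of Kronecker products of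
  -- positive semidefinite matrices.
  have hsum : (1 - (s : 𝕜) • ∑ p, jewelTuple E p ⊗ₖ X p) =
      ∑ j, J j ⊗ₖ (1 - ∑ p, (jewelVertex k j p : 𝕜) • X p) := by
    have h1 : (s : 𝕜) • ∑ p, jewelTuple E p ⊗ₖ X p =
        ∑ j, J j ⊗ₖ (∑ p, (jewelVertex k j p : 𝕜) • X p) := by
      simp only [Finset.smul_sum, ← Matrix.smul_kronecker, hJE]
      ext ⟨a, b⟩ ⟨a', b'⟩
      simp only [Matrix.sum_apply, Matrix.kroneckerMap_apply, Matrix.smul_apply, Finset.sum_mul,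
        Finset.mul_sum, smul_eq_mul]
      rw [Finset.sum_comm]
      exact Finset.sum_congr rfl fun j _ => Finset.sum_congr rfl fun p _ => by ring
    have h2 : (1 : Matrix (Fin d × Fin d) (Fin d × Fin d) 𝕜) = ∑ j, J j ⊗ₖ 1 := by
      rw [← Matrix.one_kronecker_one, ← hJ.2]
      ext ⟨a, b⟩ ⟨a', b'⟩
      simp only [Matrix.sum_apply, Matrix.kroneckerMap_apply, Finset.sum_mul]
    rw [h1, h2, ← Finset.sum_sub_distrib]
    refine Finset.sum_congr rfl fun j _ => ?_
    ext ⟨a, b⟩ ⟨a', b'⟩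
    simp only [Matrix.sub_apply, Matrix.kroneckerMap_apply, mul_sub]
  have hpsd : (1 - (s : 𝕜) • ∑ p, jewelTuple E p ⊗ₖ X p).PosSemidef := by
    rw [hsum]
    exact Matrix.posSemidef_sum _ fun j _ => (hJ.1 j).kronecker (hX j)
  have := hpsd.re_dotProduct_nonneg v
  rw [Matrix.sub_mulVec, dotProduct_sub, Matrix.one_mulVec, hv, Matrix.smul_mulVec,
    dotProduct_smul, smul_eq_mul, map_sub, RCLike.re_ofReal_mul, RCLike.one_re] at this
  rw [kroneckerForm]
  linarith

/-- The converse of `mul_kroneckerForm_le_one_of_isCompatible`. -/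
theorem isCompatible_noisy_of_forall_lambdaMax_le {E : MeasTuple 𝕜 d k} (hd : 0 < d)
    (hk : ∀ x, 0 < k x) (hE : ∀ x, IsPOVM (E x)) {m : ℝ} (hm : 0 < m)
    (h : ∀ X ∈ matrixJewel 𝕜 k d, lambdaMax (∑ p, jewelTuple E p ⊗ₖ X p) ≤ m) :
    IsCompatible (noisy (1 / m) E) := by
  have : Nonempty (Fin d) := ⟨⟨0, hd⟩⟩
  have : Nonempty ((x : Fin g) → Fin (k x)) := ⟨fun x => ⟨0, hk x⟩⟩
  rw [isCompatible_noisy_iff hk fun x => (hE x).2]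
  refine exists_isPOVM_of_forall_posSemidef (jewelVertex k) (sum_jewelVertex k) (fun p => ?_)
    fun X hXH hX => ?_
  · have := jewelTuple_isHermitian hE p
    rw [Matrix.IsHermitian, Matrix.conjTranspose_smul, this.eq]
    simp
  · have hXm : X ∈ matrixJewel 𝕜 k d := mem_matrixJewel_iff.mpr ⟨hXH, hX⟩
    have hH := isHermitian_sum_kronecker (jewelTuple_isHermitian hE) hXH
    have h1 := (posSemidef_lambdaMax_smul_one_sub hH).add
      (Matrix.PosSemidef.one.smul (show (0 : 𝕜) ≤
        ((m - lambdaMax (∑ p, jewelTuple E p ⊗ₖ X p) : ℝ) : 𝕜) by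
          exact_mod_cast sub_nonneg.mpr (h X hXm)))
    have h2 := h1.smul (show (0 : 𝕜) ≤ ((1 / m : ℝ) : 𝕜) by exact_mod_cast (by positivity))
    convert h2 using 1
    rw [RCLike.ofReal_sub m, sub_smul, sub_add_sub_cancel', smul_sub, smul_smul,
      ← RCLike.ofReal_mul, one_div_mul_cancel hm.ne', RCLike.ofReal_one, one_smul, Finset.smul_sum]
    simp only [Matrix.smul_kronecker]

theorem isPOVM_deterministic (j : (x : Fin g) → Fin (k x)) (x : Fin g) :
    IsPOVM (fun i => if j x = i then (1 : Matrix (Fin d) (Fin d) 𝕜) else 0) := by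
  refine ⟨fun i => ?_, by simp⟩
  dsimp only
  split_ifs
  · exact Matrix.PosSemidef.one
  · exact Matrix.PosSemidef.zero

/-- There is a pair for which the pairing is `1` in every vector state. -/
theorem exists_kroneckerForm_eq_one (hk : ∀ x, 0 < k x) (hk2 : ∃ x, 2 ≤ k x) :
    ∃ A ∈ dualFreePolytope (matrixJewel 𝕜 k) d, ∃ X ∈ matrixJewel 𝕜 k d,
      ∀ v, star v ⬝ᵥ v = 1 → kroneckerForm A X v = 1 := by
  obtain ⟨x, hx⟩ := hk2
  -- Always returning outcome `0` gives the scalar tuple at the vertex of `j`. Outcome `0` is not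
  -- the last one where `k x ≥ 2`, so the facet functional for that `x` takes the value `1` there.
  let j : (x : Fin g) → Fin (k x) := fun x => ⟨0, hk x⟩
  let E : MeasTuple 𝕜 d k := fun x i => if j x = i then 1 else 0
  have hE : ∀ x, IsPOVM (E x) := isPOVM_deterministic j
  refine ⟨jewelTuple E, jewelTuple_mem_dualFreePolytope hk hE, _,
    smul_one_mem_matrixJewel (smul_sumFunctional_dotProduct_jewelVertex_le hk x), fun v hv => ?_⟩
  have hA : ∀ p, jewelTuple E p = (jewelVertex k j p : 𝕜) • 1 := fun p => by
    rw [jewelTuple_eq_sum fun x => (hE x).2, Finset.sum_eq_single (j p.1)]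
    · simp [E, jewelVertex]
    · intro l _ hl
      simp [E, hl.symm]
    · simp
  have hval := smul_sumFunctional_dotProduct_jewelVertex hk x j
  rw [if_neg (show ¬ (j x).val = k x - 1 by simp only [j]; omega), mul_zero, sub_zero] at hval
  rw [kroneckerForm]
  simp only [hA, Matrix.smul_kronecker, Matrix.kronecker_smul, Matrix.one_kronecker_one, smul_smul,
    ← RCLike.ofReal_mul, ← Finset.sum_smul, ← RCLike.ofReal_sum]
  rw [show ∑ p, (((k x : ℝ) / 2) • sumFunctional k x) p * jewelVertex k j p = 1 from hval, RCLike.ofReal_one, one_smul, Matrix.one_mulVec, hv,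
    RCLike.one_re]

end Main

end MatrixJewel

theorem mainTheorem9 {𝕜 : Type*} [RCLike 𝕜] (g d : ℕ) (hd : 0 < d)
    (k : Fin g → ℕ) (hk : ∀ x, 0 < k x) (hk2 : ∃ x, 2 ≤ k x) :
    (∀ E : MeasTuple 𝕜 d k, (∀ x, IsPOVM (E x)) →
      IsGreatest (compatParams E) (compatDegree E)) ∧
    IsLeast (compatDegrees 𝕜 d k) (minCompatDegree 𝕜 d k) ∧
    0 < minCompatDegree 𝕜 d k ∧
    IsGreatest
      {t : ℝ | ∃ A ∈ dualFreePolytope (matrixJewel 𝕜 k) d, ∃ X ∈ matrixJewel 𝕜 k d,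
        t = lambdaMax (∑ p, A p ⊗ₖ X p)}
      (1 / minCompatDegree 𝕜 d k) := by
  have : Nonempty (Fin d) := ⟨⟨0, hd⟩⟩
  have hHerm : ∀ A ∈ dualFreePolytope (matrixJewel 𝕜 k) d, ∀ X ∈ matrixJewel 𝕜 k d,
      (∑ p, A p ⊗ₖ X p).IsHermitian := fun A hA X hX => isHermitian_sum_kronecker hA.1 hX.1
  obtain ⟨A₁, hA₁, X₁, hX₁, h₁⟩ := exists_kroneckerForm_eq_one (𝕜 := 𝕜) (d := d) hk hk2
  obtain ⟨v₁, hv₁, -⟩ := exists_unit_vector_lambdaMax (hHerm A₁ hA₁ X₁ hX₁)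
  obtain ⟨⟨A₀, X₀, v₀⟩, ⟨hA₀, hX₀, hv₀⟩, hmax⟩ :=
    ((isCompact_dualFreePolytope_matrixJewel (𝕜 := 𝕜) (d := d) hk).prod
      ((isCompact_matrixJewel (𝕜 := 𝕜) hk d).prod isCompact_unit_vectors)).exists_isMaxOn
      ⟨(A₁, X₁, v₁), hA₁, hX₁, hv₁⟩ continuous_kroneckerForm.continuousOn
  let m := kroneckerForm A₀ X₀ v₀
  have hle : ∀ A ∈ dualFreePolytope (matrixJewel 𝕜 k) d, ∀ X ∈ matrixJewel 𝕜 k d,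
      lambdaMax (∑ p, A p ⊗ₖ X p) ≤ m := fun A hA X hX => by
    obtain ⟨v, hv, hval⟩ := exists_unit_vector_lambdaMax (hHerm A hA X hX)
    rw [← hval]
    exact hmax (show (A, X, v) ∈ _ from ⟨hA, hX, hv⟩)
  -- Needed because noise parameters are capped at `1`: it places `1 / m` in `[0, 1]`.
  have hm1 : 1 ≤ m := by
    rw [← h₁ v₁ hv₁]
    exact hmax (show (A₁, X₁, v₁) ∈ _ from ⟨hA₁, hX₁, hv₁⟩)
  have hm0 : 0 < m := zero_lt_one.trans_le hm1
  have hparam : ∀ E : MeasTuple 𝕜 d k, (∀ x, IsPOVM (E x)) → 1 / m ∈ compatParams E :=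
    fun E hE => ⟨⟨by positivity, (div_le_one hm0).mpr hm1⟩,
      isCompatible_noisy_of_forall_lambdaMax_le hd hk hE hm0
        (hle _ (jewelTuple_mem_dualFreePolytope hk hE))⟩
  have hgreatest : ∀ E : MeasTuple 𝕜 d k, (∀ x, IsPOVM (E x)) →
      IsGreatest (compatParams E) (compatDegree E) := fun E hE =>
    (isCompact_compatParams E).isGreatest_sSup ⟨_, hparam E hE⟩
  -- The measurements behind the maximising tuple are the least compatible: for them `s * m ≤ 1` is
  -- tested at the maximiser itself.
  obtain ⟨E₀, hE₀, rfl⟩ := exists_eq_jewelTuple_of_mem_dualFreePolytope hk hA₀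
  have hdeg : compatDegree E₀ = 1 / m := by
    refine le_antisymm ?_ ((hgreatest E₀ hE₀).2 (hparam E₀ hE₀))
    rw [le_div_iff₀ hm0]
    exact mul_kroneckerForm_le_one_of_isCompatible hk hE₀ (hgreatest E₀ hE₀).1.2 hX₀ hv₀
  have hleast : IsLeast (compatDegrees 𝕜 d k) (1 / m) := by
    refine ⟨⟨E₀, hE₀, hdeg.symm⟩, ?_⟩
    rintro _ ⟨E, hE, rfl⟩
    exact (hgreatest E hE).2 (hparam E hE)
  have hmin : minCompatDegree 𝕜 d k = 1 / m := hleast.csInf_eq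
  rw [hmin, one_div_one_div]
  refine ⟨hgreatest, hleast, by positivity, ⟨jewelTuple E₀, hA₀, X₀, hX₀, ?_⟩, ?_⟩
  · exact le_antisymm (re_dotProduct_mulVec_le_lambdaMax (hHerm _ hA₀ _ hX₀) hv₀)
      (hle _ hA₀ _ hX₀)
  · rintro _ ⟨A, hA, X, hX, rfl⟩
    exact hle A hA X hX
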